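/- **Conventions.** An algebra has a signature consisting of finitary operation symbols; a variety is the class of all algebras of a given signature satisfying a given set of identities. $\operatorname{Con}(\mathbf A)$ is the lattice of congruences of $\mathbf A$, $\circ$ is the relational product ($a\mathrel{(R\circ S)}b$ iff $a\mathrel R c\mathrel S b$ for some $c$), and for a congruence $\tau$ and a binary relation $R$, $\tau\vee R$ is the least congruence containing $\tau$ and $R$. For $\alpha,\beta,\delta\in\operatorname{Con}(\mathbf A)$, $C(\alpha,\beta;\delta)$ means: for every polynomial operation $f$ of $\mathbf A$ in $n+m$ variables and all tuples $\mathbf a\equiv_\alpha\mathbf b$ in $A^n$ and $\mathbf u\equiv_\beta\mathbf v$ in $A^m$, $f(\mathbf a,\mathbf u)\equiv_\delta f(\mathbf a,\mathbf v)$ implies $f(\mathbf b,\mathbf u)\equiv_\delta f(\mathbf b,\mathbf v)$. The commutator $[\alpha,\beta]$ is the least $\delta$ with $C(\alpha,\beta;\delta)$, and $\mathbf A$ is abelian if $[1,1]=0$. For terms $p,q$ of arity $k$, $\mathcal V\models p\approx_C q$ means that for all $\mathbf A\in\mathcal V$, all $\theta\in\operatorname{Con}(\mathbf A)$ and all $a_1,\dots,a_k$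 in one $\theta$-class, $p(a_1,\dots,a_k)\mathrel{[\theta,\theta]}q(a_1,\dots,a_k)$. A term $t$ is idempotent in $\mathcal V$ if $\mathcal V\models t(x,\dots,x)\approx x$. $\mathcal V$ is Taylor if for some $n$ it has an idempotent $n$-ary term $t$ such that for each $i\in\{1,\dots,n\}$ it satisfies an identity $t(x_{i1},\dots,x_{in})\approx t(y_{i1},\dots,y_{in})$ with all $x_{ij},y_{ij}\in\{x,y\}$ and $x_{ii}\ne y_{ii}$. The idempotent reduct of $\mathcal V$ is the variety whose operation symbols are the idempotent terms of $\mathcal V$, generated by the algebras $\mathbf A\in\mathcal V$ taken with only their idempotent term operations. The Herringbone terms are the lattice terms $y^0(x,y,z)=y$, $y^{n+1}(x,y,z)=y\vee(x\wedge y^n(x,z,y))$. For congruences $\alpha_1,\dots,\alpha_6,\beta_1,\dots,\beta_6,\rho$ of an algebra put $\tau=\bigwedge_{i=1}^6(\alpha_i\vee\beta_i)$ and, for $i=1,2$, $$\theta_i(\rho)=\Big(\bigvee_{j\in L_i}\alpha_j\vee\bigvee_{j\in L_i'}\beta_j\Big)\wedge\Big(\rho\circ\Big(\bigvee_{j\in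 R_i}\alpha_j\vee\bigvee_{j\in R_i'}\beta_j\Big)\Big),$$ a binary relation, where $L_1=L_2=\{1,5,6\}$, $L_1'=L_2'=\{2,3,4\}$, $R_1=\{2,4,6\}$, $R_1'=\{1,3,5\}$, $R_2=\{3,4,5\}$, $R_2'=\{1,2,6\}$. Let $I(\rho)$ be the inclusion $$\bigwedge_{i=1}^6(\alpha_i\circ\beta_i)\le\Big(\bigvee_{i=1}^6\alpha_i\wedge\bigwedge_{i=1}^2(\tau\vee\theta_i(\rho))\Big)\vee\Big(\bigvee_{i=1}^6\beta_i\wedge\bigwedge_{i=1}^2(\tau\vee\theta_i(\rho))\Big).$$ **Theorem.** Let $\mathcal V$ be a variety. The following are equivalent: 1. $\mathcal V$ is Taylor; 2. the variety $\mathcal V'$ generated by the abelian algebras in the idempotent reduct of $\mathcal V$ is Taylor; 3. for some $6$-ary term $t$, $\mathcal V$ satisfies the commutator equations $t(x,y,y,y,x,x)\approx_C t(y,x,y,x,y,x)\approx_C t(y,y,x,x,x,y)$ and $t(x,x,x,x,x,x)\approx_C x$; 4. for all $\mathbf A\in\mathcal V$ and all $\alpha_1,\dots,\alpha_6,\beta_1,\dots,\beta_6\in\operatorname{Con}(\mathbf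 A)$, the inclusion $I([\tau,\tau])$ holds; 5. there is $n\in\mathbb N$ such that for all $\mathbf A\in\mathcal V$ and all $\alpha_1,\dots,\alpha_6,\beta_1,\dots,\beta_6\in\operatorname{Con}(\mathbf A)$, the inclusion $I\big(\bigwedge_{i=1}^5(\alpha_i\vee\beta_i)\wedge\beta_6^n\big)$ holds, where $\beta_6^n=y^n\big(\bigwedge_{i=1}^5(\alpha_i\vee\beta_i),\beta_6,\alpha_6\big)$. -/

import Mathlib

universe u w x

namespace UA

/-! ## Congruences

An algebra of signature `L` is a type `A` with `[L.Structure A]`, where `L` is a language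
without relation symbols. -/

/-- A congruence of the algebra `A`: an equivalence relation that is preserved by every
basic operation. -/
structure Congr (L : FirstOrder.Language.{u, 0}) (A : Type w) [L.Structure A] extends Setoid A where
  map_fun : ∀ {n : ℕ} (f : L.Functions n) (a b : Fin n → A),
    (∀ i, r (a i) (b i)) →
      r (FirstOrder.Language.Structure.funMap f a) (FirstOrder.Language.Structure.funMap f b)

namespace Congr

variable {L : FirstOrder.Language.{u, 0}} {A : Type w} [L.Structure A]

instance : CoeFun (Congr L A) (fun _ => A → A → Prop) := ⟨fun c => c.r⟩

theorem refl (c : Congr L A) (a : A) : c a a := c.iseqv.refl a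

theorem symm (c : Congr L A) {a b : A} (h : c a b) : c b a := c.iseqv.symm h

theorem trans (c : Congr L A) {a b d : A} (h : c a b) (h' : c b d) : c a d :=
  c.iseqv.trans h h'

theorem ext' {c d : Congr L A} (h : ∀ a b, c a b ↔ d a b) : c = d := by
  obtain ⟨s, hs⟩ := c
  obtain ⟨t, ht⟩ := d
  have : s = t := Setoid.ext h
  subst this
  rfl

instance : PartialOrder (Congr L A) where
  le c d := ∀ ⦃a b : A⦄, c a b → d a b
  le_refl _ _ _ h := h
  le_trans _ _ _ h h' _ _ hab := h' (h hab)
  le_antisymm _ _ h h' := ext' fun _ _ => ⟨fun hab => h hab, fun hab => h' hab⟩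

theorem le_def {c d : Congr L A} : c ≤ d ↔ ∀ ⦃a b : A⦄, c a b → d a b := Iff.rfl

instance : InfSet (Congr L A) where
  sInf S :=
    { r := fun a b => ∀ c ∈ S, c a b
      iseqv := ⟨fun a c _ => c.refl a, fun h c hc => c.symm (h c hc),
        fun h h' c hc => c.trans (h c hc) (h' c hc)⟩
      map_fun := fun f a b h c hc => c.map_fun f a b fun i => h i c hc }

/-- The lattice `Con(A)`, ordered by inclusion. Meets are intersections; the join is the least
congruence above. -/
instance : CompleteLattice (Congr L A) where
  __ := completeLatticeOfInf (Congr L A) fun _ =>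
    ⟨fun c hc _ _ h => h c hc, fun _ hd _ _ h c hc => hd hc h⟩
  inf c d :=
    { r := fun a b => c a b ∧ d a b
      iseqv := ⟨fun a => ⟨c.refl a, d.refl a⟩, fun h => ⟨c.symm h.1, d.symm h.2⟩,
        fun h h' => ⟨c.trans h.1 h'.1, d.trans h.2 h'.2⟩⟩
      map_fun := fun f a b h =>
        ⟨c.map_fun f a b fun i => (h i).1, d.map_fun f a b fun i => (h i).2⟩ }
  inf_le_left _ _ _ _ h := h.1
  inf_le_right _ _ _ _ h := h.2
  le_inf _ _ _ h h' _ _ hab := ⟨h hab, h' hab⟩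
  top :=
    { r := fun _ _ => True
      iseqv := ⟨fun _ => trivial, fun _ => trivial, fun _ _ => trivial⟩
      map_fun := fun _ _ _ _ => trivial }
  le_top _ _ _ _ := trivial
  bot :=
    { r := fun a b => a = b
      iseqv := ⟨fun _ => rfl, fun h => h.symm, fun h h' => h.trans h'⟩
      map_fun := fun f _ _ h => congrArg (FirstOrder.Language.Structure.funMap f) (funext h) }
  bot_le c _ _ h := by
    cases h
    exact c.refl _

/-- The congruence generated by a binary relation. -/
def gen (R : A → A → Prop) : Congr L A := sInf {c | ∀ a b, R a b → c a b}

end Congr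

/-! ## Centralizer and (term condition) commutator -/

section Commutator

variable {L : FirstOrder.Language.{u, 0}} {A : Type w} [L.Structure A]

/-- `f` is a polynomial operation of `A` in the variables `ι`: a term operation some of whose
arguments have been replaced by elements of `A`. -/
def IsPolynomial (L : FirstOrder.Language.{u, 0}) {A : Type w} [L.Structure A] {ι : Type}
    (f : (ι → A) → A) : Prop :=
  ∃ t : L.Term (A ⊕ ι), ∀ v : ι → A, f v = t.realize (Sum.elim id v)

/-- `C(α, β; δ)`: `α` centralizes `β` modulo `δ`. -/
def Centralizes (α β δ : Congr L A) : Prop :=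
  ∀ (n m : ℕ) (f : (Fin n ⊕ Fin m → A) → A), IsPolynomial L f →
    ∀ (a b : Fin n → A) (u v : Fin m → A),
      (∀ i, α (a i) (b i)) → (∀ j, β (u j) (v j)) →
      δ (f (Sum.elim a u)) (f (Sum.elim a v)) →
      δ (f (Sum.elim b u)) (f (Sum.elim b v))

/-- The commutator `[α, β]`: the least `δ` with `C(α, β; δ)`. -/
def comm (α β : Congr L A) : Congr L A := sInf {δ | Centralizes α β δ}

/-- `[α, β]` does satisfy `C(α, β; [α, β])`, so that the infimum is a minimum. -/
theorem centralizes_comm (α β : Congr L A) : Centralizes α β (comm α β) :=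
  fun n m f hf a b u v hab huv h δ hδ => hδ n m f hf a b u v hab huv (h δ hδ)

end Commutator

/-- The algebra `A` is abelian: `[1, 1] = 0`. -/
def IsAbelian (L : FirstOrder.Language.{u, 0}) (A : Type w) [L.Structure A] : Prop :=
  comm (⊤ : Congr L A) ⊤ = ⊥

/-! ## Equations and varieties -/

/-- `A ⊨ s ≈ t`. -/
def Satisfies {L : FirstOrder.Language.{u, 0}} (A : Type w) [L.Structure A] {ι : Type x}
    (s t : L.Term ι) : Prop :=
  ∀ v : ι → A, s.realize v = t.realize v

/-- `A ⊨ s ≈_C t`: for every congruence `θ` of `A` the two terms are `[θ, θ]`-related at all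
tuples of elements lying in one `θ`-class. -/
def SatisfiesComm {L : FirstOrder.Language.{u, 0}} (A : Type w) [L.Structure A] {ι : Type x}
    (s t : L.Term ι) : Prop :=
  ∀ (θ : Congr L A) (v : ι → A), (∀ i j, θ (v i) (v j)) →
    comm θ θ (s.realize v) (t.realize v)

/-- A variety of signature `L`: the class of all algebras that satisfy a given set of
identities, which are written in the countably many variables indexed by `ℕ`. -/
structure Variety (L : FirstOrder.Language.{u, 0}) where
  identities : Set (L.Term ℕ × L.Term ℕ)

namespace Variety

variable {L : FirstOrder.Language.{u, 0}}

/-- `A` belongs to the variety `V`. -/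
def Mem (V : Variety L) (A : Type u) [L.Structure A] : Prop :=
  ∀ e ∈ V.identities, Satisfies A e.1 e.2

/-- `V ⊨ s ≈ t`. -/
def Sat (V : Variety L) {ι : Type x} (s t : L.Term ι) : Prop :=
  ∀ (A : Type u) [L.Structure A], V.Mem A → Satisfies A s t

/-- `V ⊨ s ≈_C t`. -/
def SatComm (V : Variety L) {ι : Type x} (s t : L.Term ι) : Prop :=
  ∀ (A : Type u) [L.Structure A], V.Mem A → SatisfiesComm A s t

/-- The variety generated by a class `K` of algebras: it is defined by all identities that hold
throughout `K`. It is the least variety containing `K`, see `mem_generatedBy` and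
`generatedBy_le`. -/
def generatedBy (K : ∀ A : Type u, L.Structure A → Prop) : Variety L where
  identities := {e | ∀ (A : Type u) (S : L.Structure A), K A S → Satisfies A e.1 e.2}

theorem mem_generatedBy (K : ∀ A : Type u, L.Structure A → Prop) (A : Type u)
    [S : L.Structure A] (h : K A S) : (generatedBy K).Mem A :=
  fun _ he => he A S h

theorem generatedBy_le (K : ∀ A : Type u, L.Structure A → Prop) (W : Variety L)
    (hW : ∀ (A : Type u) (S : L.Structure A), K A S → W.Mem A) (A : Type u) [L.Structure A]
    (h : (generatedBy K).Mem A) : W.Mem A :=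
  fun e he => h e fun B S hB => hW B S hB e he

/-- The `n`-ary term `t` is idempotent in `V`: `V ⊨ t(x, …, x) ≈ x`. -/
def Idempotent (V : Variety L) {n : ℕ} (t : L.Term (Fin n)) : Prop :=
  V.Sat (t.relabel fun _ => (0 : Fin 1)) (FirstOrder.Language.Term.var 0)

/-- The `n`-ary term `t` is a Taylor term of `V`: it is idempotent, and for every position `i`
the variety satisfies an equation `t(x_{i1}, …, x_{in}) ≈ t(y_{i1}, …, y_{in})` in two variables
(numbered `0` and `1`) with different variables at position `i`. -/
def IsTaylorTerm (V : Variety L) {n : ℕ} (t : L.Term (Fin n)) : Prop :=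
  V.Idempotent t ∧ ∃ p q : Fin n → Fin n → Fin 2, ∀ i : Fin n,
    p i i ≠ q i i ∧ V.Sat (t.relabel (p i)) (t.relabel (q i))

/-- `V` is a Taylor variety. -/
def IsTaylor (V : Variety L) : Prop :=
  ∃ (n : ℕ) (t : L.Term (Fin n)), V.IsTaylorTerm t

/-- The signature of the idempotent reduct of `V`: one `n`-ary operation symbol for each `n`-ary
idempotent term of `V`. -/
def idempLanguage (V : Variety L) : FirstOrder.Language.{u, 0} where
  Functions n := {t : L.Term (Fin n) // V.Idempotent t}
  Relations _ := Empty

instance (V : Variety L) : V.idempLanguage.IsAlgebraic :=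
  fun _ => inferInstanceAs (IsEmpty Empty)

/-- The idempotent reduct of an algebra: the operation symbol `t` is interpreted as the term
operation of `t`. -/
@[reducible] def idempStructure (V : Variety L) (A : Type u) [L.Structure A] :
    V.idempLanguage.Structure A where
  funMap t a := t.1.realize a
  RelMap r _ := Empty.elim r

/-- The idempotent reduct of `V`: the variety generated by the idempotent reducts of the
algebras in `V`. -/
def idempReduct (V : Variety L) : Variety V.idempLanguage :=
  generatedBy fun A S => ∃ _T : L.Structure A, V.Mem A ∧ S = V.idempStructure A

/-- The variety generated by the abelian algebras of `V`. -/
def abelianPart (V : Variety L) : Variety L :=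
  generatedBy fun A S => letI := S; V.Mem A ∧ IsAbelian L A

end Variety

/-! ## The congruence inclusions -/

/-- The Herringbone lattice terms: `y⁰(x, y, z) = y` and
`yⁿ⁺¹(x, y, z) = y ∨ (x ∧ yⁿ(x, z, y))`. -/
def herringbone {X : Type w} [Lattice X] : ℕ → X → X → X → X
  | 0, _, y, _ => y
  | n + 1, x, y, z => y ⊔ (x ⊓ herringbone n x z y)

section Inclusions

variable {L : FirstOrder.Language.{u, 0}} {A : Type w} [L.Structure A]

/-- `τ = ⋀_{i=1}^{6} (α_i ∨ β_i)`. Here and below the indices `1, …, 6` are numbered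
`0, …, 5`. -/
def tau (α β : Fin 6 → Congr L A) : Congr L A := ⨅ i, (α i ⊔ β i)

/-- `⋀_{i=1}^{5} (α_i ∨ β_i)`. -/
def tauFive (α β : Fin 6 → Congr L A) : Congr L A :=
  ⨅ i : Fin 5, (α i.castSucc ⊔ β i.castSucc)

/-- `⋁_{j ∈ S} α_j ∨ ⋁_{j ∈ S'} β_j`. -/
def joinOver (α β : Fin 6 → Congr L A) (S S' : Finset (Fin 6)) : Congr L A :=
  (⨆ j ∈ S, α j) ⊔ (⨆ j ∈ S', β j)

/-- `(⋁_{j ∈ L} α_j ∨ ⋁_{j ∈ L'} β_j) ∧ (ρ ∘ (⋁_{j ∈ R} α_j ∨ ⋁_{j ∈ R'} β_j))` for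
`L = {1, 5, 6}` and `L' = {2, 3, 4}`, as a binary relation; `∘` is the relational product. -/
def theta (ρ : Congr L A) (α β : Fin 6 → Congr L A) (R R' : Finset (Fin 6)) (a b : A) : Prop :=
  joinOver α β {0, 4, 5} {1, 2, 3} a b ∧ Relation.Comp ρ (joinOver α β R R') a b

/-- `θ₁`, with `R₁ = {2, 4, 6}` and `R₁' = {1, 3, 5}`. -/
def thetaOne (ρ : Congr L A) (α β : Fin 6 → Congr L A) : A → A → Prop :=
  theta ρ α β {1, 3, 5} {0, 2, 4}

/-- `θ₂`, with `R₂ = {3, 4, 5}` and `R₂' = {1, 2, 6}`. -/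
def thetaTwo (ρ : Congr L A) (α β : Fin 6 → Congr L A) : A → A → Prop :=
  theta ρ α β {2, 3, 4} {0, 1, 5}

/-- `τ ∨ R` for a congruence `τ` and a binary relation `R`: the least congruence containing
both. -/
def joinRel (τ : Congr L A) (R : A → A → Prop) : Congr L A :=
  Congr.gen fun a b => τ a b ∨ R a b

/-- The inclusion
`⋀ᵢ (αᵢ ∘ βᵢ) ⊆ (⋁ᵢ αᵢ ∧ ⋀ₖ (τ ∨ θₖ)) ∨ (⋁ᵢ βᵢ ∧ ⋀ₖ (τ ∨ θₖ))`, `i ≤ 6`, `k ≤ 2`, where `θ₁`, `θ₂`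
are formed with the congruence `ρ`. -/
def TaylorInclusion (ρ : Congr L A) (α β : Fin 6 → Congr L A) : Prop :=
  let σ := joinRel (tau α β) (thetaOne ρ α β) ⊓ joinRel (tau α β) (thetaTwo ρ α β)
  ∀ a b : A, (∀ i, Relation.Comp (α i) (β i) a b) →
    (((⨆ i, α i) ⊓ σ) ⊔ ((⨆ i, β i) ⊓ σ)) a b

end Inclusions

end UA

/-! The conditions are proved in a cycle. In an abelian algebra, whether exchanging `x` and `y` in
some arguments preserves the value of a term depends only on a sign pattern `d`: variables → {-1, 0,
1}, not on what stands where `d` is zero. Such patterns (`Balanced`) are closed under negation and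
under sums that remain sign-valued, and they pass to star products. A Taylor term has, for each
variable, a pattern that does not vanish there. `exists_nonvanishing` merges these patterns, in an
iterated star product, into one pair `(p, q)` whose value at every variable is a root of A₂. The six
roots are the six columns of xyyyxx, yxyxyx, yyxxxy, so identifying variables with equal roots gives
Olšák's equations. A θ-class modulo [θ, θ] is an abelian algebra of the idempotent reduct, which
turns them into commutator equations (`satComm_translate`).

Applied to elements with a αᵢ cᵢ βᵢ b, these equations make t(c) a link between a and b, which gives
the inclusion with ρ = [τ, τ]. This commutator lies below a union of herringbone congruences
(`comm_tau_le`). In the free algebra on a, b, c₁, …, c₆ a finite stage of the union suffices, and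
homomorphisms carry that stage to every algebra of the variety.

If the variety is not Taylor, compactness yields a choice of one variable in every idempotent term
that respects linear equations (`exists_selection`). The generic inclusion can then be tested on
partitions of the bare set {a, b, c₁, …, c₆}, where its right side is trivial and cannot relate a to
b (`not_upperBound`). -/

namespace UA

open FirstOrder Language

/-! ### Generated congruences, directed unions and quotients. -/

section Basics

variable {L : FirstOrder.Language.{u, 0}} {A : Type w} [L.Structure A]

/-- If changing a single argument along `r` changes the value of `g` along the preorder `P`,
then so does changing all arguments. -/
theorem rel_of_rel_update {ι : Type*} {B C : Type*} [Fintype ι] [DecidableEq ι]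
    {r : B → B → Prop} {P : C → C → Prop} (hrefl : ∀ z, P z z)
    (htrans : ∀ z₁ z₂ z₃, P z₁ z₂ → P z₂ z₃ → P z₁ z₃) (g : (ι → B) → C)
    (h : ∀ v i p q, r p q → P (g (Function.update v i p)) (g (Function.update v i q)))
    (a b : ι → B) (hab : ∀ i, r (a i) (b i)) : P (g a) (g b) := by
  have key : ∀ S : Finset ι, P (g a) (g (S.piecewise b a)) := by
    intro S
    induction S using Finset.induction_on with
    | empty => simpa using hrefl _
    | insert j S hj ih =>
      refine htrans _ _ _ ih ?_
      rw [Finset.piecewise_insert]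
      have hs : S.piecewise b a = Function.update (S.piecewise b a) j (a j) := by
        conv_lhs => rw [← Function.update_eq_self j (S.piecewise b a)]
        simp [hj]
      have := h (S.piecewise b a) j _ _ (hab j)
      rwa [← hs] at this
  simpa only [Finset.piecewise_univ] using key Finset.univ

namespace Congr

theorem rel_realize (c : Congr L A) {ι : Type x} (t : L.Term ι) {v v' : ι → A}
    (h : ∀ i, c (v i) (v' i)) : c (t.realize v) (t.realize v') := by
  induction t with
  | var i => exact h i
  | func f ts ih => exact c.map_fun f _ _ ih

theorem rel_update (c : Congr L A) {ι : Type*} [DecidableEq ι] (v : ι → A) (i : ι) {p q : A}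
    (h : c p q) (j : ι) : c (Function.update v i p j) (Function.update v i q j) := by
  by_cases hj : j = i
  · subst hj; simpa using h
  · simpa only [Function.update_of_ne hj] using c.refl _

theorem gen_le {R : A → A → Prop} {c : Congr L A} (h : ∀ a b, R a b → c a b) : gen R ≤ c :=
  sInf_le h

theorem gen_of {R : A → A → Prop} {a b : A} (h : R a b) : gen (L := L) R a b :=
  fun _ hc => hc a b h

/-- `R` is preserved by the unary translations built from basic operations. -/
def TranslationClosed (L : FirstOrder.Language.{u, 0}) {A : Type w} [L.Structure A]
    (R : A → A → Prop) : Prop :=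
  ∀ {n : ℕ} (f : L.Functions n) (v : Fin n → A) (i : Fin n) (p q : A), R p q →
    R (Structure.funMap f (Function.update v i p)) (Structure.funMap f (Function.update v i q))

theorem translationClosed (c : Congr L A) : TranslationClosed L (fun a b => c a b) :=
  fun f v i _ _ h => c.map_fun f _ _ (c.rel_update v i h)

/-- The equivalence relation generated by a translation closed relation is a congruence. -/
theorem gen_le_setoid {R : A → A → Prop} (hR : TranslationClosed L R) (s : Setoid A)
    (h : ∀ a b, R a b → s a b) {a b : A} (hab : gen (L := L) R a b) : s a b := by
  let c : Congr L A :=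
    { toSetoid := Relation.EqvGen.setoid R
      map_fun := by
        intro n f a b hab
        refine rel_of_rel_update (r := Relation.EqvGen R) (P := Relation.EqvGen R)
          Relation.EqvGen.refl Relation.EqvGen.trans _ ?_ a b hab
        intro v i p q hpq
        induction hpq with
        | rel p q hpq => exact .rel _ _ (hR f v i p q hpq)
        | refl p => exact .refl _
        | symm p q _ ih => exact .symm _ _ ih
        | trans p q r _ _ ih ih' => exact .trans _ _ _ ih ih' }
  have hc : Relation.EqvGen R a b := hab c fun p q hpq => Relation.EqvGen.rel p q hpq
  induction hc with
  | rel p q hpq => exact h _ _ hpq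
  | refl p => exact s.refl _
  | symm p q hpq ih => exact s.symm (ih fun c hc => c.symm (hab c hc))
  | trans p q r hpq hqr ih ih' =>
    have lift : ∀ {y z}, Relation.EqvGen R y z → gen (L := L) R y z := by
      intro y z hyz d hd
      induction hyz with
      | rel p q hpq => exact hd _ _ hpq
      | refl p => exact d.refl _
      | symm p q _ ih => exact d.symm ih
      | trans p q r _ _ ih ih' => exact d.trans ih ih'
    exact s.trans (ih (lift hpq)) (ih' (lift hqr))

theorem TranslationClosed.or {R S : A → A → Prop} (hR : TranslationClosed L R)
    (hS : TranslationClosed L S) : TranslationClosed L fun a b => R a b ∨ S a b :=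
  fun f v i p q h => h.imp (hR f v i p q) (hS f v i p q)

/-- Joins of congruences are joins of equivalence relations, so `s` need not be compatible with the
operations. This allows bounds by kernels of maps that are not homomorphisms. -/
theorem sup_le_setoid {c d : Congr L A} (s : Setoid A) (hc : ∀ a b, c a b → s a b)
    (hd : ∀ a b, d a b → s a b) {a b : A} (h : (c ⊔ d) a b) : s a b := by
  refine gen_le_setoid (TranslationClosed.or c.translationClosed d.translationClosed) s
    (fun a b h => h.elim (hc a b) (hd a b)) (a := a) (b := b) ?_
  have hle : c ⊔ d ≤ gen (L := L) fun a b => c a b ∨ d a b :=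
    sup_le (fun _ _ h => gen_of (Or.inl h)) fun _ _ h => gen_of (Or.inr h)
  exact hle h

theorem iInf_apply {ι : Sort*} {c : ι → Congr L A} {a b : A} :
    (⨅ i, c i) a b ↔ ∀ i, c i a b := by
  constructor
  · intro h i
    exact iInf_le c i h
  · rintro h _ ⟨i, rfl⟩
    exact h i

theorem translationClosed_comp (c d : Congr L A) :
    TranslationClosed L (Relation.Comp (fun a b => c a b) fun a b => d a b) := by
  rintro n f v i p q ⟨r, hpr, hrq⟩
  exact ⟨_, c.translationClosed f v i _ _ hpr, d.translationClosed f v i _ _ hrq⟩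

theorem translationClosed_theta (ρ : Congr L A) (α β : Fin 6 → Congr L A) (R R' : Finset (Fin 6)) :
    TranslationClosed L (theta ρ α β R R') :=
  fun f v i p q h => ⟨translationClosed _ f v i p q h.1,
    translationClosed_comp _ _ f v i p q h.2⟩

/-- The preimage of a congruence under a homomorphism. -/
def comap {B : Type*} [L.Structure B] (h : A → B)
    (hom : ∀ {n : ℕ} (f : L.Functions n) (v : Fin n → A),
      h (Structure.funMap f v) = Structure.funMap f fun i => h (v i)) (c : Congr L B) :
    Congr L A where
  toSetoid := c.toSetoid.comap h
  map_fun f a b hab := by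
    change c _ _
    rw [hom, hom]
    exact c.map_fun f _ _ hab

/-! ### Directed unions -/

/-- The union of an increasing sequence of congruences. -/
def union (c : ℕ → Congr L A) (hc : Monotone c) : Congr L A where
  r a b := ∃ n, c n a b
  iseqv := ⟨fun a => ⟨0, (c 0).refl a⟩, fun ⟨n, h⟩ => ⟨n, (c n).symm h⟩,
    fun ⟨n, h⟩ ⟨m, h'⟩ => ⟨max n m,
      (c _).trans (hc (le_max_left n m) h) (hc (le_max_right n m) h')⟩⟩
  map_fun f a b hab := by
    choose k hk using hab
    exact ⟨Finset.univ.sup k, (c _).map_fun f a b fun i =>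
      hc (Finset.le_sup (Finset.mem_univ i)) (hk i)⟩

theorem le_union (c : ℕ → Congr L A) (hc : Monotone c) (n : ℕ) : c n ≤ union c hc :=
  fun _ _ h => ⟨n, h⟩

/-! ### Quotients -/

/-- The quotient algebra. -/
def Quot (c : Congr L A) : Type w := Quotient c.toSetoid

/-- The class of an element in the quotient algebra. -/
def cls (c : Congr L A) (a : A) : c.Quot := Quotient.mk c.toSetoid a

/-- A representative of a class. -/
noncomputable def rep (c : Congr L A) (q : c.Quot) : A := Quotient.out q

theorem cls_rep (c : Congr L A) (q : c.Quot) : c.cls (c.rep q) = q := Quotient.out_eq q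

theorem cls_eq_iff (c : Congr L A) {a b : A} : c.cls a = c.cls b ↔ c a b :=
  ⟨fun h => Quotient.exact h, fun h => Quotient.sound h⟩

noncomputable instance (c : Congr L A) : L.Structure c.Quot where
  funMap f v := c.cls (Structure.funMap f fun i => c.rep (v i))
  RelMap _ _ := False

theorem funMap_cls (c : Congr L A) {n : ℕ} (f : L.Functions n) (v : Fin n → A) :
    Structure.funMap f (fun i => c.cls (v i)) = c.cls (Structure.funMap f v) :=
  c.cls_eq_iff.2 (c.map_fun f _ _ fun _ => c.cls_eq_iff.1 (c.cls_rep _))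

theorem realize_cls (c : Congr L A) {ι : Type x} (t : L.Term ι) (v : ι → A) :
    t.realize (fun i => c.cls (v i)) = c.cls (t.realize v) := by
  induction t with
  | var i => rfl
  | func f ts ih =>
    simp only [Term.realize_func, ih]
    exact c.funMap_cls f _

end Congr

theorem Satisfies.quot {ι : Type x} {s t : L.Term ι} (h : Satisfies A s t) (c : Congr L A) :
    Satisfies c.Quot s t := by
  intro v
  have hv : v = fun i => c.cls (c.rep (v i)) := funext fun i => (c.cls_rep _).symm
  rw [hv, c.realize_cls, c.realize_cls, h]

theorem isAbelian_of_centralizes (h : Centralizes (⊤ : Congr L A) ⊤ ⊥) : IsAbelian L A :=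
  le_bot_iff.1 (sInf_le h)

theorem comm_bot : comm (⊥ : Congr L A) ⊥ = ⊥ := by
  refine le_bot_iff.1 (sInf_le ?_)
  intro n m f _ a b u v hab huv h
  have hab' : a = b := funext hab
  rwa [← hab']

end Basics

/-! ### Free algebras -/

section Free

variable {L : FirstOrder.Language.{u, 0}}

instance termStructure (X : Type x) : L.Structure (L.Term X) where
  funMap f v := Term.func f v
  RelMap _ _ := False

theorem realize_term {X : Type x} {ι : Type w} (t : L.Term ι) (v : ι → L.Term X) :
    t.realize v = t.subst v := by
  induction t with
  | var i => rfl
  | func f ts ih => simp only [Term.realize_func, ih]; rfl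

namespace Variety

variable (V : Variety L)

theorem Sat.refl {V : Variety L} {ι : Type x} (s : L.Term ι) : V.Sat s s := fun _ _ _ _ => rfl

theorem Sat.symm {V : Variety L} {ι : Type x} {s t : L.Term ι} (h : V.Sat s t) : V.Sat t s :=
  fun A _ hA v => (h A hA v).symm

theorem Sat.trans {V : Variety L} {ι : Type x} {s t r : L.Term ι} (h : V.Sat s t)
    (h' : V.Sat t r) : V.Sat s r :=
  fun A _ hA v => (h A hA v).trans (h' A hA v)

theorem Sat.relabel {V : Variety L} {ι : Type*} {κ : Type*} {s t : L.Term ι} (h : V.Sat s t)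
    (σ : ι → κ) : V.Sat (s.relabel σ) (t.relabel σ) := by
  intro A _ hA v
  rw [Term.realize_relabel, Term.realize_relabel, h A hA]

/-- The fully invariant congruence of the term algebra. -/
def freeCongr (X : Type) : Congr L (L.Term X) where
  r s t := V.Sat s t
  iseqv := ⟨Sat.refl, Sat.symm, Sat.trans⟩
  map_fun f a b h := by
    intro A _ hA v
    change (Term.func f a).realize v = (Term.func f b).realize v
    simp only [Term.realize_func]
    congr 1
    exact funext fun i => h i A hA v

/-- The free algebra of `V` over `X`. -/
abbrev Free (X : Type) : Type u := (V.freeCongr X).Quot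

theorem free_mem (X : Type) : V.Mem (V.Free X) := by
  intro e he v
  have hv : v = fun i => (V.freeCongr X).cls ((V.freeCongr X).rep (v i)) :=
    funext fun i => ((V.freeCongr X).cls_rep _).symm
  rw [hv, Congr.realize_cls, Congr.realize_cls, Congr.cls_eq_iff, realize_term, realize_term]
  intro A _ hA v'
  rw [Term.realize_subst, Term.realize_subst]
  exact hA e he _

/-- The homomorphism of the free algebra that extends a map on the generators. -/
noncomputable def lift {X : Type} {A : Type u} [L.Structure A] (v : X → A) (q : V.Free X) : A :=
  ((V.freeCongr X).rep q).realize v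

theorem lift_cls {X : Type} {A : Type u} [L.Structure A] (hA : V.Mem A) (v : X → A)
    (t : L.Term X) : V.lift v ((V.freeCongr X).cls t) = t.realize v :=
  (V.freeCongr X).cls_eq_iff.1 ((V.freeCongr X).cls_rep _) A hA v

theorem lift_funMap {X : Type} {A : Type u} [L.Structure A] (hA : V.Mem A) (v : X → A) {n : ℕ}
    (f : L.Functions n) (q : Fin n → V.Free X) :
    V.lift v (Structure.funMap f q) = Structure.funMap f fun i => V.lift v (q i) :=
  V.lift_cls hA v _

/-- The generators of the free algebra. -/
def gen {X : Type} (i : X) : V.Free X := (V.freeCongr X).cls (Term.var i)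

theorem lift_gen {X : Type} {A : Type u} [L.Structure A] (hA : V.Mem A) (v : X → A) (i : X) :
    V.lift v (V.gen i) = v i :=
  V.lift_cls hA v _

theorem sat_generatedBy {K : ∀ A : Type u, L.Structure A → Prop} {k : ℕ} {s t : L.Term (Fin k)}
    (h : ∀ (A : Type u) (S : L.Structure A), K A S → Satisfies A s t) :
    (generatedBy K).Sat s t := by
  intro A _ hA v
  classical
  -- Identities use variables from `ℕ`; the surplus ones need some value, and the value of `s`
  -- supplies one even when `k = 0`.
  have : Nonempty A := ⟨s.realize v⟩
  have hmem := hA (s.relabel Fin.val, t.relabel Fin.val) (by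
    intro B S hB v'
    simp only [Term.realize_relabel]
    exact h B S hB _)
  have := hmem (fun i => if hi : i < k then v ⟨i, hi⟩ else Classical.arbitrary A)
  simp only [Term.realize_relabel] at this
  have hcomp : (fun i : ℕ => if hi : i < k then v ⟨i, hi⟩ else Classical.arbitrary A) ∘ Fin.val = v := by
    funext i; simp
  rwa [hcomp] at this

end Variety

end Free

/-! ### Signed relations of terms in abelian algebras -/

section Balanced

variable {L : FirstOrder.Language.{u, 0}} {A : Type w} [L.Structure A]

/-- The term condition for terms with a finite set of variables. -/
theorem term_condition (hA : Centralizes (⊤ : Congr L A) ⊤ ⊥) {Y : Type} [Finite Y]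
    (T : L.Term Y) (Z : Y → Prop) {a b a' b' : Y → A} (h₁ : ∀ i, Z i → a i = b i)
    (h₂ : ∀ i, Z i → a' i = b' i) (h₃ : ∀ i, ¬ Z i → a i = a' i) (h₄ : ∀ i, ¬ Z i → b i = b' i)
    (h : T.realize a = T.realize b) : T.realize a' = T.realize b' := by
  classical
  obtain ⟨n, ⟨e⟩⟩ := Finite.exists_equiv_fin Y
  let φ : Y → Fin n ⊕ Fin n := fun i => if Z i then Sum.inl (e i) else Sum.inr (e i)
  have hφ : ∀ p q r : Y → A, (∀ i, Z i → p i = r i) → (∀ i, ¬ Z i → q i = r i) →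
      Sum.elim (p ∘ e.symm) (q ∘ e.symm) ∘ φ = r := by
    intro p q r hp hq
    funext i
    by_cases hi : Z i
    · simp [φ, hi, hp]
    · simp [φ, hi, hq]
  have hpoly : IsPolynomial L (A := A) fun v : Fin n ⊕ Fin n → A => T.realize (v ∘ φ) := by
    refine ⟨T.relabel fun i => Sum.inr (φ i), fun v => ?_⟩
    rw [Term.realize_relabel]
    rfl
  have := hA n n _ hpoly (a ∘ e.symm) (a' ∘ e.symm) (a ∘ e.symm) (b ∘ e.symm)
    (fun _ => trivial) (fun _ => trivial)
  rw [hφ a a a (fun _ _ => rfl) (fun _ _ => rfl), hφ a b b h₁ (fun _ _ => rfl),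
    hφ a' a a' (fun _ _ => rfl) h₃, hφ a' b b' h₂ h₄] at this
  exact this h

/-- The pair `(p, q)` is `(x, y)`, `(y, x)` or constant if `d` is `1`, `-1` or `0`,
respectively. -/
def SwapPair (d : SignType) (x y p q : A) : Prop :=
  (d = 0 → p = q) ∧ (d = 1 → p = x ∧ q = y) ∧ (d = -1 → p = y ∧ q = x)

/-- The term operation of `T` does not change when `x` and `y` are interchanged in the way that
is described by `d`. -/
def Balanced (A : Type w) [L.Structure A] {Y : Type} (T : L.Term Y) (d : Y → SignType) : Prop :=
  ∀ (x y : A) (a b : Y → A), (∀ i, SwapPair (d i) x y (a i) (b i)) → T.realize a = T.realize b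

/-- The term condition replaces the common entries at the zeros of `d` by any others, so one witness
for each `x`, `y` is enough. -/
theorem balanced_of_exists (hA : Centralizes (⊤ : Congr L A) ⊤ ⊥) {Y : Type} [Finite Y]
    {T : L.Term Y} {d : Y → SignType}
    (h : ∀ x y : A, ∃ a b : Y → A, (∀ i, SwapPair (d i) x y (a i) (b i)) ∧
      T.realize a = T.realize b) : Balanced A T d := by
  intro x y a' b' hab'
  obtain ⟨a, b, hab, heq⟩ := h x y
  have key : ∀ i, d i ≠ 0 → a i = a' i ∧ b i = b' i := by
    intro i hi
    rcases SignType.trichotomy (d i) with h | h | h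
    · rw [((hab i).2.2 h).1, ((hab i).2.2 h).2, ((hab' i).2.2 h).1, ((hab' i).2.2 h).2]
      exact ⟨rfl, rfl⟩
    · exact absurd h hi
    · rw [((hab i).2.1 h).1, ((hab i).2.1 h).2, ((hab' i).2.1 h).1, ((hab' i).2.1 h).2]
      exact ⟨rfl, rfl⟩
  exact term_condition hA T (fun i => d i = 0) (fun i => (hab i).1) (fun i => (hab' i).1)
    (fun i hi => (key i hi).1) (fun i hi => (key i hi).2) heq

theorem Balanced.zero {Y : Type} (T : L.Term Y) : Balanced A T fun _ => 0 := by
  intro x y a b h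
  rw [funext fun i => (h i).1 rfl]

theorem Balanced.smul {Y : Type} {T : L.Term Y} {d : Y → SignType} (h : Balanced A T d)
    (s : SignType) : Balanced A T fun i => s * d i := by
  intro x y a b hab
  rcases SignType.trichotomy s with rfl | rfl | rfl
  · have key : ∀ (e : SignType) (p q : A), SwapPair (-1 * e) x y p q → SwapPair e y x p q := by
      intro e p q
      cases e <;> simp [SwapPair]
    exact h y x a b fun i => key _ _ _ (hab i)
  · rw [funext fun i => (hab i).1 (by simp)]
  · exact h x y a b (by simpa using hab)

/-- Two exchanges are chained through a middle tuple: `p` to `q` follows `d`, `q` to `r` follows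
`e`, and `p` to `r` follows `s`. The entries at zeros are chosen so that the two steps fit together.
-/
theorem Balanced.add (hA : Centralizes (⊤ : Congr L A) ⊤ ⊥) {Y : Type} [Finite Y]
    {T : L.Term Y} {d e s : Y → SignType} (hd : Balanced A T d) (he : Balanced A T e)
    (hs : ∀ i, (s i : ℤ) = d i + e i) : Balanced A T s := by
  refine balanced_of_exists hA fun x y => ?_
  let p : SignType → SignType → A := fun d e => if d = -1 ∨ d = 0 ∧ e = -1 then y else x
  let q : SignType → SignType → A := fun d e => if d = 1 ∨ d = 0 ∧ e = -1 then y else x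
  let r : SignType → SignType → A :=
    fun d e => if d = 1 ∧ e ≠ -1 ∨ d = 0 ∧ e = 1 ∨ d = -1 ∧ e = 1 then y else x
  have h₁ : ∀ d e, SwapPair d x y (p d e) (q d e) := by
    intro d e
    cases d <;> cases e <;> simp [SwapPair, p, q]
  have h₂ : ∀ s d e : SignType, (s : ℤ) = d + e →
      SwapPair e x y (q d e) (r d e) ∧ SwapPair s x y (p d e) (r d e) := by
    intro s d e
    cases d <;> cases e <;> cases s <;> simp [SwapPair, p, q, r]
  exact ⟨fun i => p (d i) (e i), fun i => r (d i) (e i), fun i => (h₂ _ _ _ (hs i)).2,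
    (hd x y _ _ fun i => h₁ (d i) (e i)).trans (he x y _ _ fun i => (h₂ _ _ _ (hs i)).1)⟩

/-- The star product of two terms. -/
def star {Y Y' : Type} (T : L.Term Y) (U : L.Term Y') : L.Term (Y × Y') :=
  T.subst fun k => U.relabel fun l => (k, l)

theorem realize_star {Y Y' : Type} (T : L.Term Y) (U : L.Term Y') (v : Y × Y' → A) :
    (star T U).realize v = T.realize fun k => U.realize fun l => v (k, l) := by
  rw [star, Term.realize_subst]
  simp only [Term.realize_relabel]
  rfl

theorem Balanced.star_right {Y Y' : Type} (T : L.Term Y) {U : L.Term Y'} {e : Y → Y' → SignType}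
    (he : ∀ k, Balanced A U (e k)) : Balanced A (star T U) fun z => e z.1 z.2 := by
  intro x y a b hab
  rw [realize_star, realize_star]
  congr 1
  exact funext fun k => he k x y _ _ fun l => hab (k, l)

/-- Each inner variable `l` may carry its own pattern of the outer term. Patterns for different `l`
have disjoint supports, so they can be added one at a time. -/
theorem Balanced.star_left (hA : Centralizes (⊤ : Congr L A) ⊤ ⊥) {Y Y' : Type} [Finite Y]
    [Finite Y'] {T : L.Term Y} (U : L.Term Y') {d : Y' → Y → SignType}
    (hd : ∀ l, Balanced A T (d l)) : Balanced A (star T U) fun z => d z.2 z.1 := by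
  classical
  have single : ∀ l₀, Balanced A (star T U) fun z => if z.2 = l₀ then d l₀ z.1 else 0 := by
    intro l₀
    refine balanced_of_exists hA fun x y => ?_
    let p : SignType → A := fun d => if d = -1 then y else x
    let q : SignType → A := fun d => if d = 1 then y else x
    refine ⟨fun z => if z.2 = l₀ then p (d l₀ z.1) else x,
      fun z => if z.2 = l₀ then q (d l₀ z.1) else x, ?_, ?_⟩
    · rintro ⟨k, l⟩
      by_cases hl : l = l₀
      · simp only [hl, if_true]
        generalize d l₀ k = c
        cases c <;> simp [SwapPair, p, q]
      · simp [hl, SwapPair]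
    -- With all other inner variables frozen at `x`, the inner term becomes a unary map `G`, and
    -- exchanging `x`, `y` becomes exchanging `G x`, `G y` in `T`.
    · rw [realize_star, realize_star]
      let G : A → A := fun z => U.realize fun l => if l = l₀ then z else x
      refine hd l₀ (G x) (G y) (fun k => G (p (d l₀ k))) (fun k => G (q (d l₀ k))) fun k => ?_
      generalize d l₀ k = c
      cases c <;> simp [SwapPair, p, q]
  have key : ∀ S : Finset Y', Balanced A (star T U) fun z => if z.2 ∈ S then d z.2 z.1 else 0 := by
    intro S
    induction S using Finset.induction_on with
    | empty => simpa using Balanced.zero _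
    | insert l₀ S hl ih =>
      refine ih.add hA (single l₀) ?_
      rintro ⟨k, l⟩
      by_cases h : l = l₀
      · subst h; simp [hl]
      · simp [h]
  have := Fintype.ofFinite Y'
  simpa using key Finset.univ

end Balanced

/-! ### Combining signed relations -/

section Combine

/-- `(p, q)` is a root of the root system `A₂` or zero. -/
def RootOrZero (p q : SignType) : Prop := p ≠ q ∨ p = 0 ∧ q = 0

instance (p q : SignType) : Decidable (RootOrZero p q) := inferInstanceAs (Decidable (_ ∨ _))

/-- The value of `p + q` in case that it is again a sign. -/
def addSign (p q : SignType) : SignType :=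
  if p = 0 then q else if q = 0 then p else if p = q then p else 0

/-- Replace `0` by `1`. -/
def unitSign (s : SignType) : SignType := if s = 0 then 1 else s

/-- The first coordinate of the contribution of the outer variable to the combined relation. -/
def outerFst (p p' q' m : SignType) (m' : SignType) : SignType :=
  if p' = q' then m else unitSign m' * p

/-- The second coordinate of the contribution of the outer variable. -/
def outerSnd (q p' q' m' : SignType) : SignType :=
  if p' = q' then 0 else unitSign m' * q

/-- The first coordinate of the contribution of the inner variable. -/
def innerFst (p q p' m m' : SignType) : SignType :=
  if p = q then p' else (if m = 0 then addSign (-p) (-q) else 0) * m'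

/-- The second coordinate of the contribution of the inner variable. -/
def innerSnd (p q q' m m' : SignType) : SignType :=
  if p = q then q' else (if m = 0 then p else 0) * m'

/-- If `(p, q)` and `(p', q')` are both nonzero, the sum is ±`(p, q)`, plus `m'` times its image
under (p, q) ↦ (-p-q, p) when `m = 0`. That map is a rotation of A₂ of order three, and a root plus
its rotation is again a root. If exactly one of the pairs is zero, or both are, the sum can vanish
only where `m` vanishes along with the zero pair. -/
theorem combine_spec : ∀ p q p' q' m m' : SignType, RootOrZero p q → RootOrZero p' q' →
    let P := outerFst p p' q' m m'
    let Q := outerSnd q p' q' m'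
    let P' := innerFst p q p' m m'
    let Q' := innerSnd p q q' m m'
    (addSign P P' : ℤ) = P + P' ∧ (addSign Q Q' : ℤ) = Q + Q' ∧
      RootOrZero (addSign P P') (addSign Q Q') ∧
      (addSign P P' = addSign Q Q' → p = q ∧ m = 0 ∨ p' = q' ∧ m' = 0) := by
  decide

variable {L : FirstOrder.Language.{u, 0}}

/-- With the inner variable frozen, the outer contribution is `m`, zero, or a sign times `p` or `q`;
with the outer variable frozen, the inner one is `p`, `q` or a sign times `m`. Hence both
contributions are balanced, and their sums stay sign-valued. -/
theorem Balanced.combine {A : Type w} [L.Structure A] (hA : Centralizes (⊤ : Congr L A) ⊤ ⊥)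
    {Y : Type} [Finite Y] {T : L.Term Y} {p q m : Y → SignType} (hp : Balanced A T p)
    (hq : Balanced A T q) (hm : Balanced A T m) (hpq : ∀ y, RootOrZero (p y) (q y)) :
    Balanced A (star T T) (fun z => addSign
      (outerFst (p z.1) (p z.2) (q z.2) (m z.1) (m z.2))
      (innerFst (p z.1) (q z.1) (p z.2) (m z.1) (m z.2))) ∧
    Balanced A (star T T) (fun z => addSign
      (outerSnd (q z.1) (p z.2) (q z.2) (m z.2))
      (innerSnd (p z.1) (q z.1) (q z.2) (m z.1) (m z.2))) := by
  have spec := fun z : Y × Y => combine_spec (p z.1) (q z.1) (p z.2) (q z.2) (m z.1) (m z.2)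
    (hpq _) (hpq _)
  have ite_bal : ∀ {c : Prop} [Decidable c] {d e : Y → SignType}, Balanced A T d →
      Balanced A T e → Balanced A T fun k => if c then d k else e k := by
    intro c _ d e hd he
    by_cases hc : c <;> simpa [hc]
  constructor
  · exact Balanced.add hA
      (Balanced.star_left hA T (d := fun l k => outerFst (p k) (p l) (q l) (m k) (m l))
        fun l => ite_bal hm (hp.smul _))
      (Balanced.star_right T (e := fun k l => innerFst (p k) (q k) (p l) (m k) (m l))
        fun k => ite_bal hp (hm.smul _)) fun z => (spec z).1
  · exact Balanced.add hA
      (Balanced.star_left hA T (d := fun l k => outerSnd (q k) (p l) (q l) (m l))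
        fun l => ite_bal (Balanced.zero T) (hq.smul _))
      (Balanced.star_right T (e := fun k l => innerSnd (p k) (q k) (q l) (m k) (m l))
        fun k => ite_bal hq (hm.smul _)) fun z => (spec z).2.1

/-- This carries the patterns not yet merged over to the star product: the new pattern vanishes only
where both coordinates are zeros of `m`. -/
theorem Balanced.firstNonzero {A : Type w} [L.Structure A]
    (hA : Centralizes (⊤ : Congr L A) ⊤ ⊥) {Y : Type} [Finite Y] {T : L.Term Y}
    {m : Y → SignType} (hm : Balanced A T m) :
    Balanced A (star T T) fun z => if m z.1 = 0 then m z.2 else m z.1 := by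
  refine Balanced.add hA (Balanced.star_left hA T (d := fun _ k => m k) fun _ => hm)
    (Balanced.star_right T (e := fun k l => if m k = 0 then m l else 0) fun k => ?_) fun z => ?_
  · by_cases h : m k = 0
    · simpa [h] using hm
    · simpa [h] using Balanced.zero T
  · by_cases h : m z.1 = 0 <;> simp [h]

/-- `d` is a signed relation of `T` in all abelian algebras of `V`. -/
def BalancedIn (V : Variety L) {Y : Type} (T : L.Term Y) (d : Y → SignType) : Prop :=
  ∀ (A : Type u) [L.Structure A], V.Mem A → Centralizes (⊤ : Congr L A) ⊤ ⊥ → Balanced A T d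

/-- If a term has signed relations that do not vanish simultaneously, then some term has an
`A₂`-valued relation that vanishes nowhere. -/
theorem exists_nonvanishing (V : Variety L) {ι Y : Type} [Finite ι] [Finite Y] (T : L.Term Y)
    (μ : ι → Y → SignType) (hμ : ∀ i, BalancedIn V T (μ i)) (cover : ∀ y, ∃ i, μ i y ≠ 0) :
    ∃ (Y' : Type) (_ : Finite Y') (T' : L.Term Y') (p q : Y' → SignType),
      BalancedIn V T' p ∧ BalancedIn V T' q ∧ ∀ y, RootOrZero (p y) (q y) ∧ p y ≠ q y := by
  classical
  -- Invariant: every zero of `(p, q)` is covered by a pattern not yet merged. Once all patterns are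
  -- merged, no zero is left.
  have key : ∀ J : Finset ι, ∃ (Y' : Type) (_ : Finite Y') (T' : L.Term Y')
      (p q : Y' → SignType) (ν : ι → Y' → SignType),
      BalancedIn V T' p ∧ BalancedIn V T' q ∧ (∀ i, BalancedIn V T' (ν i)) ∧
      (∀ y, RootOrZero (p y) (q y)) ∧ ∀ y, p y = q y → ∃ i ∉ J, ν i y ≠ 0 := by
    intro J
    induction J using Finset.induction_on with
    | empty =>
      exact ⟨Y, inferInstance, T, fun _ => 0, fun _ => 0, μ, fun A _ _ _ => Balanced.zero T,
        fun A _ _ _ => Balanced.zero T, hμ, fun _ => Or.inr ⟨rfl, rfl⟩,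
        fun y _ => by simpa using cover y⟩
    | insert i₀ J _ ih =>
      obtain ⟨Y', _, T', p, q, ν, hp, hq, hν, hpq, hJ⟩ := ih
      refine ⟨Y' × Y', inferInstance, star T' T', _, _,
        fun i z => if ν i z.1 = 0 then ν i z.2 else ν i z.1,
        fun A _ hV hA => (Balanced.combine hA (hp A hV hA) (hq A hV hA) (hν i₀ A hV hA) hpq).1,
        fun A _ hV hA => (Balanced.combine hA (hp A hV hA) (hq A hV hA) (hν i₀ A hV hA) hpq).2,
        fun i A _ hV hA => Balanced.firstNonzero hA (hν i A hV hA), fun z => ?_, fun z hz => ?_⟩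
      · exact (combine_spec _ _ _ _ _ _ (hpq _) (hpq _)).2.2.1
      · have hnew : ∀ y, p y = q y → ν i₀ y = 0 → ∃ i ∉ insert i₀ J, ν i y ≠ 0 := by
          intro y hy h0
          obtain ⟨i, hi, hne⟩ := hJ y hy
          refine ⟨i, fun h => ?_, hne⟩
          rcases Finset.mem_insert.1 h with rfl | h
          exacts [hne h0, hi h]
        rcases (combine_spec _ _ _ _ _ _ (hpq _) (hpq _)).2.2.2 hz with ⟨h, h0⟩ | ⟨h, h0⟩
        · obtain ⟨i, hi, hne⟩ := hnew _ h h0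
          exact ⟨i, hi, by simp [hne]⟩
        · obtain ⟨i, hi, hne⟩ := hnew _ h h0
          exact ⟨i, hi, by by_cases h' : ν i z.1 = 0 <;> simp [h', hne]⟩
  have := Fintype.ofFinite ι
  obtain ⟨Y', hY', T', p, q, ν, hp, hq, _, hpq, h⟩ := key Finset.univ
  exact ⟨Y', hY', T', p, q, hp, hq, fun y => ⟨hpq y, fun hy => by simpa using h y hy⟩⟩

/-- The position of a root in the rows of Olšák's equations. -/
def rootIndex (p q : SignType) : Fin 6 :=
  if p = 1 then if q = 0 then 0 else 4
  else if p = -1 then if q = 0 then 3 else 1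
  else if q = -1 then 2 else 5

/-- In each column, `p` records the change from the first row to the second and `q` the change from
the second to the third; the six columns realize the six roots. -/
theorem swapPair_rootIndex {A : Type w} (v : Fin 2 → A) : ∀ p q : SignType, RootOrZero p q →
    p ≠ q → SwapPair p (v 0) (v 1) (v ((![0, 1, 1, 1, 0, 0] : Fin 6 → Fin 2) (rootIndex p q)))
      (v ((![1, 0, 1, 0, 1, 0] : Fin 6 → Fin 2) (rootIndex p q))) ∧
    SwapPair q (v 0) (v 1) (v ((![1, 0, 1, 0, 1, 0] : Fin 6 → Fin 2) (rootIndex p q)))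
      (v ((![1, 1, 0, 0, 0, 1] : Fin 6 → Fin 2) (rootIndex p q))) := by
  intro p q
  cases p <;> cases q <;> simp [SwapPair, rootIndex]

/-- Olšák's equations hold in all abelian algebras of a variety in which the equations of a Taylor
term hold. -/
theorem exists_olsak_of_taylor_equations (V W : Variety L)
    (hVW : ∀ (A : Type u) [L.Structure A], V.Mem A → Centralizes (⊤ : Congr L A) ⊤ ⊥ → W.Mem A)
    {n : ℕ} (t : L.Term (Fin n)) (p q : Fin n → Fin n → Fin 2)
    (h : ∀ i, p i i ≠ q i i ∧ W.Sat (t.relabel (p i)) (t.relabel (q i))) :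
    ∃ s : L.Term (Fin 6), ∀ (A : Type u) [L.Structure A], V.Mem A →
      Centralizes (⊤ : Congr L A) ⊤ ⊥ →
      Satisfies A (s.relabel ![(0 : Fin 2), 1, 1, 1, 0, 0]) (s.relabel ![1, 0, 1, 0, 1, 0]) ∧
      Satisfies A (s.relabel ![(1 : Fin 2), 0, 1, 0, 1, 0]) (s.relabel ![1, 1, 0, 0, 0, 1]) := by
  -- The pattern of the `i`-th Taylor identity is the difference of its two sides; it is nonzero at
  -- position `i`.
  let μ : Fin n → Fin n → SignType := fun i k =>
    if p i k = q i k then 0 else if p i k = 0 then 1 else -1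
  obtain ⟨Y, _, T, a, b, ha, hb, hab⟩ := exists_nonvanishing V t μ
    (fun i A _ hV hA => balanced_of_exists hA fun x y => ⟨![x, y] ∘ p i, ![x, y] ∘ q i, by
      intro k
      simp only [μ, Function.comp]
      generalize p i k = c
      generalize q i k = d
      fin_cases c <;> fin_cases d <;> simp [SwapPair], by
      have := (h i).2 A (hVW A hV hA) ![x, y]
      rwa [Term.realize_relabel, Term.realize_relabel] at this⟩)
    (fun i => ⟨i, by
      simp only [μ, if_neg (h i).1]
      split_ifs <;> decide⟩)
  refine ⟨T.relabel fun y => rootIndex (a y) (b y), fun A _ hV hA => ⟨fun v => ?_, fun v => ?_⟩⟩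
  · simp only [Term.realize_relabel]
    exact ha A hV hA (v 0) (v 1) _ _ fun y => (swapPair_rootIndex v _ _ (hab y).1 (hab y).2).1
  · simp only [Term.realize_relabel]
    exact hb A hV hA (v 0) (v 1) _ _ fun y => (swapPair_rootIndex v _ _ (hab y).1 (hab y).2).2

end Combine

/-! ### Terms of the idempotent reduct -/

namespace Variety

variable {L : FirstOrder.Language.{u, 0}} (V : Variety L)

theorem Idempotent.realize_const {V : Variety L} {n : ℕ} {t : L.Term (Fin n)}
    (ht : V.Idempotent t) {A : Type u} [L.Structure A] (hA : V.Mem A) (a : A) :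
    t.realize (fun _ => a) = a := by
  have := ht A hA fun _ => a
  rwa [Term.realize_relabel] at this

/-- A term of the idempotent reduct, written as a term of `V`. -/
def translate {ι : Type x} : V.idempLanguage.Term ι → L.Term ι
  | .var i => .var i
  | .func f ts => f.1.subst fun i => translate (ts i)

theorem translate_relabel {ι : Type x} {κ : Type w} (t : V.idempLanguage.Term ι) (σ : ι → κ) :
    V.translate (t.relabel σ) = (V.translate t).relabel σ := by
  have key : ∀ {κ' : Type} (s : L.Term κ') (τ : κ' → L.Term ι),
      (s.subst τ).relabel σ = s.subst fun i => (τ i).relabel σ := by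
    intro κ' s τ
    induction s with
    | var i => rfl
    | func f ts ih => simp [Term.subst, Term.relabel, ih]
  induction t with
  | var i => rfl
  | func f ts ih =>
    change f.1.subst (fun i => V.translate ((ts i).relabel σ)) = _
    simp only [ih]
    exact (key _ _).symm

theorem realize_translate {ι : Type x} (A : Type u) [L.Structure A]
    (t : V.idempLanguage.Term ι) (v : ι → A) :
    (V.translate t).realize v =
      @Term.realize V.idempLanguage A (V.idempStructure A) ι v t := by
  let _ := V.idempStructure A
  induction t with
  | var i => rfl
  | func f ts ih =>
    rw [translate, Term.realize_subst]
    simp only [ih]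
    rfl

theorem translate_const {A : Type u} [L.Structure A] (hA : V.Mem A) {ι : Type x}
    (t : V.idempLanguage.Term ι) (a : A) : (V.translate t).realize (fun _ => a) = a := by
  induction t with
  | var i => rfl
  | func f ts ih =>
    rw [translate, Term.realize_subst]
    simp only [ih]
    exact f.2.realize_const hA a

/-- A congruence class, as a subalgebra of the idempotent reduct. -/
@[reducible] def classStructure {A : Type u} [L.Structure A] (hA : V.Mem A) (θ : Congr L A)
    (o : A) : V.idempLanguage.Structure {a : A // θ o a} where
  funMap f v := ⟨f.1.realize fun i => (v i).1, by
    have := θ.rel_realize f.1 (v := fun _ => o) (v' := fun i => (v i).1) fun i => (v i).2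
    rwa [f.2.realize_const hA] at this⟩
  RelMap r _ := Empty.elim r

theorem coe_realize_class {A : Type u} [L.Structure A] (hA : V.Mem A) (θ : Congr L A)
    (o : A) {ι : Type x} (t : V.idempLanguage.Term ι) (v : ι → {a : A // θ o a}) :
    (@Term.realize V.idempLanguage _ (V.classStructure hA θ o) ι v t).1 =
      (V.translate t).realize fun i => (v i).1 := by
  let _ := V.classStructure hA θ o
  induction t with
  | var i => rfl
  | func f ts ih =>
    rw [translate, Term.realize_subst]
    simp only [← ih]
    rfl

/-- Equations that hold in the abelian algebras of the idempotent reduct of `V` are commutator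
equations of `V`. -/
theorem satComm_translate {ι : Type x} (i₀ : ι) {s t : V.idempLanguage.Term ι}
    (h : ∀ (B : Type u) [V.idempLanguage.Structure B], V.idempReduct.Mem B →
      Centralizes (⊤ : Congr V.idempLanguage B) ⊤ ⊥ → Satisfies B s t) :
    V.SatComm (V.translate s) (V.translate t) := by
  intro A _ hA θ v hv
  let _ := V.classStructure hA θ (v i₀)
  -- The class is a subalgebra because only idempotent operations are kept; `δ` is the restriction
  -- of [θ, θ] to it.
  let δ : Congr V.idempLanguage {a : A // θ (v i₀) a} :=
    { r := fun a b => comm θ θ a.1 b.1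
      iseqv := ⟨fun a => (comm θ θ).refl _, fun h => (comm θ θ).symm h,
        fun h h' => (comm θ θ).trans h h'⟩
      map_fun := fun f a b hab => (comm θ θ).rel_realize f.1 hab }
  have hmem : V.idempReduct.Mem δ.Quot := by
    intro e he
    refine Satisfies.quot (fun w => Subtype.ext ?_) δ
    rw [coe_realize_class, coe_realize_class, realize_translate, realize_translate]
    exact he A (V.idempStructure A) ⟨_, hA, rfl⟩ _
  -- Polynomials of the quotient lift to polynomials of `A` with parameters in the class. All
  -- arguments are then θ-related, so the term condition C(θ, θ; [θ, θ]) applies.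
  have hab : Centralizes (⊤ : Congr V.idempLanguage δ.Quot) ⊤ ⊥ := by
    rintro n m f ⟨T, hT⟩ a b c d - - hf
    have lift : ∀ w : Fin n ⊕ Fin m → δ.Quot, f w = δ.cls (T.realize
        (Sum.elim δ.rep fun i => δ.rep (w i))) := by
      intro w
      rw [hT, ← δ.realize_cls]
      congr 1
      funext z
      rcases z with z | z <;> exact (δ.cls_rep _).symm
    have val : ∀ w : Fin n ⊕ Fin m → {a : A // θ (v i₀) a},
        (T.realize (Sum.elim δ.rep w)).1 = (V.translate T).realize
          (Sum.elim (fun q => (δ.rep q).1) fun i => (w i).1) := by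
      intro w
      rw [coe_realize_class]
      congr 1
      funext z
      rcases z with z | z <;> rfl
    have hpoly : IsPolynomial L (A := A) fun w : Fin n ⊕ Fin m → A =>
        (V.translate T).realize (Sum.elim (fun q => (δ.rep q).1) w) := by
      refine ⟨(V.translate T).relabel (Sum.map (fun q => (δ.rep q).1) id), fun w => ?_⟩
      rw [Term.realize_relabel]
      refine congrArg (fun v => Term.realize v (V.translate T)) (funext fun z => ?_)
      rcases z with z | z <;> rfl
    have rel : ∀ p q : δ.Quot, θ (δ.rep p).1 (δ.rep q).1 :=
      fun p q => θ.trans (θ.symm (δ.rep p).2) (δ.rep q).2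
    have elim_eq : ∀ (p : Fin n → δ.Quot) (q : Fin m → δ.Quot),
        (fun i => (δ.rep (Sum.elim p q i)).1) =
          Sum.elim (fun i => (δ.rep (p i)).1) fun j => (δ.rep (q j)).1 := by
      intro p q
      funext z
      rcases z with z | z <;> rfl
    have key := centralizes_comm θ θ n m _ hpoly (fun i => (δ.rep (a i)).1)
      (fun i => (δ.rep (b i)).1) (fun i => (δ.rep (c i)).1) (fun i => (δ.rep (d i)).1)
      (fun i => rel _ _) (fun i => rel _ _)
    simp only [← elim_eq, ← val] at key
    change f _ = f _ at hf
    change f _ = f _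
    rw [lift, lift, δ.cls_eq_iff] at hf ⊢
    exact key hf
  have := h δ.Quot hmem hab fun i => δ.cls ⟨v i, hv i₀ i⟩
  rw [δ.realize_cls, δ.realize_cls, δ.cls_eq_iff] at this
  have this : comm θ θ _ _ := this
  rwa [coe_realize_class, coe_realize_class] at this

theorem abelianPart_mem {V : Variety L} {A : Type u} [S : L.Structure A] (hA : V.Mem A)
    (h : Centralizes (⊤ : Congr L A) ⊤ ⊥) : V.abelianPart.Mem A :=
  mem_generatedBy _ A (S := S) ⟨hA, isAbelian_of_centralizes h⟩

/-- The abelian part of the idempotent reduct of a Taylor variety is Taylor. -/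
theorem IsTaylor.abelianPart_idempReduct {V : Variety L} (h : V.IsTaylor) :
    V.idempReduct.abelianPart.IsTaylor := by
  obtain ⟨n, t, ht, p, q, hpq⟩ := h
  let f : V.idempLanguage.Functions n := ⟨t, ht⟩
  have sat : ∀ {k : ℕ} {r s : V.idempLanguage.Term (Fin k)},
      V.Sat (V.translate r) (V.translate s) → V.idempReduct.abelianPart.Sat r s := by
    intro k r s hrs
    have hred : V.idempReduct.Sat r s := by
      refine sat_generatedBy ?_
      rintro A _ ⟨_, hA, rfl⟩ v
      rw [← realize_translate, ← realize_translate]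
      exact hrs A hA v
    exact sat_generatedBy fun A _ hA => hred A hA.1
  refine ⟨n, f.term, sat ?_, p, q, fun i => ⟨(hpq i).1, sat ?_⟩⟩
  · intro A _ hA v
    rw [translate_relabel, Term.realize_relabel, realize_translate]
    exact (congrArg t.realize (funext fun i => rfl)).trans (ht.realize_const hA (v 0))
  · intro A _ hA v
    have := (hpq i).2 A hA v
    rw [Term.realize_relabel, Term.realize_relabel] at this
    rw [translate_relabel, translate_relabel, Term.realize_relabel, Term.realize_relabel,
      realize_translate, realize_translate]
    exact this

/-- Idempotence of the resulting term holds exactly, not just modulo commutators, because every term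
of the idempotent reduct is idempotent. -/
theorem exists_olsak_commutator_term {V : Variety L} (h : V.idempReduct.abelianPart.IsTaylor) :
    ∃ t : L.Term (Fin 6),
      V.SatComm (t.relabel ![(0 : Fin 2), 1, 1, 1, 0, 0]) (t.relabel ![1, 0, 1, 0, 1, 0]) ∧
      V.SatComm (t.relabel ![(1 : Fin 2), 0, 1, 0, 1, 0]) (t.relabel ![1, 1, 0, 0, 0, 1]) ∧
      V.SatComm (t.relabel ![(0 : Fin 1), 0, 0, 0, 0, 0]) (Term.var 0) := by
  obtain ⟨n, t, -, p, q, hpq⟩ := h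
  obtain ⟨s, hs⟩ := exists_olsak_of_taylor_equations V.idempReduct V.idempReduct.abelianPart
    (fun A _ => abelianPart_mem) t p q hpq
  refine ⟨V.translate s, ?_, ?_, ?_⟩
  · simp only [← translate_relabel]
    exact V.satComm_translate 0 fun B _ hB hB' => (hs B hB hB').1
  · simp only [← translate_relabel]
    exact V.satComm_translate 0 fun B _ hB hB' => (hs B hB hB').2
  · intro A _ hA θ v _
    rw [Term.realize_relabel]
    have hv : v ∘ ![(0 : Fin 1), 0, 0, 0, 0, 0] = fun _ => v 0 :=
      funext fun i => congrArg v (Subsingleton.elim _ _)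
    rw [hv, translate_const V hA]
    exact (comm θ θ).refl _

end Variety

/-! ### The congruence inclusion with the commutator -/

section Inclusion

variable {L : FirstOrder.Language.{u, 0}} {A : Type w} [L.Structure A]

theorem joinOver_left {α β : Fin 6 → Congr L A} {S S' : Finset (Fin 6)} {j : Fin 6} (hj : j ∈ S) :
    α j ≤ joinOver α β S S' :=
  le_sup_of_le_left (le_iSup₂_of_le j hj le_rfl)

theorem joinOver_right {α β : Fin 6 → Congr L A} {S S' : Finset (Fin 6)} {j : Fin 6}
    (hj : j ∈ S') : β j ≤ joinOver α β S S' :=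
  le_sup_of_le_right (le_iSup₂_of_le j hj le_rfl)

theorem joinRel_left (τ : Congr L A) (R : A → A → Prop) : τ ≤ joinRel τ R :=
  fun _ _ h => Congr.gen_of (Or.inl h)

theorem joinRel_right (τ : Congr L A) {R : A → A → Prop} {a b : A} (h : R a b) :
    joinRel τ R a b :=
  Congr.gen_of (Or.inr h)

/-- `⋀ₖ (τ ∨ θₖ)`. -/
def sigma (ρ : Congr L A) (α β : Fin 6 → Congr L A) : Congr L A :=
  joinRel (tau α β) (thetaOne ρ α β) ⊓ joinRel (tau α β) (thetaTwo ρ α β)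

/-- The right hand side of the congruence inclusion. -/
def upperBound (ρ : Congr L A) (α β : Fin 6 → Congr L A) : Congr L A :=
  ((⨆ i, α i) ⊓ sigma ρ α β) ⊔ ((⨆ i, β i) ⊓ sigma ρ α β)

theorem taylorInclusion_iff {ρ : Congr L A} {α β : Fin 6 → Congr L A} :
    TaylorInclusion ρ α β ↔
      ∀ a b, (∀ i, Relation.Comp (α i) (β i) a b) → upperBound ρ α β a b :=
  Iff.rfl

/-- The link is t(c): a = t(a, …, a) is ⋁αᵢ-related to t(c), which is ⋁βᵢ-related to t(b, …, b) = b.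
The commutator equations serve to place t(c) in the σ-class of a. -/
theorem taylorInclusion_of_term (t : L.Term (Fin 6))
    (h₁ : SatisfiesComm A (t.relabel ![(0 : Fin 2), 1, 1, 1, 0, 0]) (t.relabel ![1, 0, 1, 0, 1, 0]))
    (h₂ : SatisfiesComm A (t.relabel ![(1 : Fin 2), 0, 1, 0, 1, 0]) (t.relabel ![1, 1, 0, 0, 0, 1]))
    (h₃ : SatisfiesComm A (t.relabel ![(0 : Fin 1), 0, 0, 0, 0, 0]) (Term.var 0))
    (α β : Fin 6 → Congr L A) : TaylorInclusion (comm (tau α β) (tau α β)) α β := by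
  rw [taylorInclusion_iff]
  intro a b hab
  have hex : ∀ i, ∃ c, α i a c ∧ β i c b := hab
  choose c hac hcb using hex
  have hτ : tau α β a b := Congr.iInf_apply.2 fun i =>
    (α i ⊔ β i).trans (le_sup_left (a := α i) (hac i)) (le_sup_right (b := β i) (hcb i))
  -- At θ = 0 the commutator equation is an equality, since [0, 0] = 0.
  have idem : ∀ z : A, t.realize (fun _ => z) = z := by
    intro z
    have := h₃ ⊥ (fun _ => z) fun _ _ => rfl
    rw [comm_bot, Term.realize_relabel] at this
    exact this
  have hcong : ∀ i j : Fin 2, tau α β (![a, b] i) (![a, b] j) := by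
    intro i j
    fin_cases i <;> fin_cases j
    exacts [(tau α β).refl _, hτ, (tau α β).symm hτ, (tau α β).refl _]
  set κ := comm (tau α β) (tau α β) with hκ
  have e₁ : κ (t.realize ![a, b, b, b, a, a]) (t.realize ![b, a, b, a, b, a]) := by
    have := h₁ (tau α β) ![a, b] hcong
    rw [Term.realize_relabel, Term.realize_relabel] at this
    convert this using 2 <;> (funext i; fin_cases i <;> rfl)
  have e₂ : κ (t.realize ![b, a, b, a, b, a]) (t.realize ![b, b, a, a, a, b]) := by
    have := h₂ (tau α β) ![a, b] hcong
    rw [Term.realize_relabel, Term.realize_relabel] at this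
    convert this using 2 <;> (funext i; fin_cases i <;> rfl)
  -- Each row goes to t(c) coordinatewise, by αᵢ where the row has a and by βᵢ where it has b. The
  -- index sets record these positions in the three rows.
  have hL : joinOver α β {0, 4, 5} {1, 2, 3} (t.realize ![a, b, b, b, a, a]) (t.realize c) := by
    refine Congr.rel_realize _ t fun i => ?_
    fin_cases i
    exacts [joinOver_left (by decide) (hac 0), joinOver_right (by decide) ((β 1).symm (hcb 1)),
      joinOver_right (by decide) ((β 2).symm (hcb 2)),
      joinOver_right (by decide) ((β 3).symm (hcb 3)), joinOver_left (by decide) (hac 4),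
      joinOver_left (by decide) (hac 5)]
  have hR₁ : joinOver α β {1, 3, 5} {0, 2, 4} (t.realize ![b, a, b, a, b, a]) (t.realize c) := by
    refine Congr.rel_realize _ t fun i => ?_
    fin_cases i
    exacts [joinOver_right (by decide) ((β 0).symm (hcb 0)), joinOver_left (by decide) (hac 1),
      joinOver_right (by decide) ((β 2).symm (hcb 2)), joinOver_left (by decide) (hac 3),
      joinOver_right (by decide) ((β 4).symm (hcb 4)), joinOver_left (by decide) (hac 5)]
  have hR₂ : joinOver α β {2, 3, 4} {0, 1, 5} (t.realize ![b, b, a, a, a, b]) (t.realize c) := by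
    refine Congr.rel_realize _ t fun i => ?_
    fin_cases i
    exacts [joinOver_right (by decide) ((β 0).symm (hcb 0)),
      joinOver_right (by decide) ((β 1).symm (hcb 1)), joinOver_left (by decide) (hac 2),
      joinOver_left (by decide) (hac 3), joinOver_left (by decide) (hac 4),
      joinOver_right (by decide) ((β 5).symm (hcb 5))]
  have hτ' : tau α β a (t.realize ![a, b, b, b, a, a]) := by
    have := (tau α β).rel_realize t (v := fun _ => a) (v' := ![a, b, b, b, a, a]) (by
      intro i
      fin_cases i
      exacts [(tau α β).refl a, hτ, hτ, hτ, (tau α β).refl a, (tau α β).refl a])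
    rwa [idem] at this
  set σ := sigma (comm (tau α β) (tau α β)) α β
  have hσ : σ a (t.realize c) :=
    ⟨(joinRel _ _).trans (joinRel_left _ _ hτ') (joinRel_right _ ⟨hL, _, e₁, hR₁⟩),
      (joinRel _ _).trans (joinRel_left _ _ hτ')
        (joinRel_right _ ⟨hL, _, κ.trans e₁ e₂, hR₂⟩)⟩
  have hστ : σ a b := ⟨joinRel_left _ _ hτ, joinRel_left _ _ hτ⟩
  have hα : (⨆ i, α i) a (t.realize c) := by
    have := (⨆ i, α i).rel_realize t (v := fun _ => a) fun i => le_iSup α i (hac i)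
    rwa [idem] at this
  have hβ : (⨆ i, β i) (t.realize c) b := by
    have := (⨆ i, β i).rel_realize t (v' := fun _ => b) fun i => le_iSup β i (hcb i)
    rwa [idem] at this
  exact Congr.trans _ (le_sup_left (a := (⨆ i, α i) ⊓ σ) ⟨hα, hσ⟩)
    (le_sup_right (b := (⨆ i, β i) ⊓ σ) ⟨hβ, σ.trans (σ.symm hσ) hστ⟩)

end Inclusion

/-! ### Herringbone congruences bound the commutator from above. -/

section Herringbone

theorem herringbone_le_succ {X : Type w} [Lattice X] (n : ℕ) (x y z : X) :
    herringbone n x y z ≤ herringbone (n + 1) x y z := by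
  induction n generalizing y z with
  | zero => exact le_sup_left
  | succ n ih => exact sup_le_sup_left (inf_le_inf_left _ (ih z y)) _

theorem herringbone_monotone {X : Type w} [Lattice X] (x y z : X) :
    Monotone fun n => herringbone n x y z :=
  monotone_nat_of_le_succ fun n => herringbone_le_succ n x y z

variable {L : FirstOrder.Language.{u, 0}} {A : Type w} [L.Structure A]

theorem IsPolynomial.rel {ι : Type} {f : (ι → A) → A} (hf : IsPolynomial L f) (c : Congr L A)
    {v v' : ι → A} (h : ∀ i, c (v i) (v' i)) : c (f v) (f v') := by
  obtain ⟨t, ht⟩ := hf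
  rw [ht, ht]
  refine c.rel_realize t fun i => ?_
  rcases i with i | i
  exacts [c.refl _, h i]

/-- `γ ∨ δ` centralizes `x` modulo `x ∧ γ = x ∧ δ`. -/
theorem centralizes_of_inf_eq {γ δ x ρ α β : Congr L A} (hγ : x ⊓ γ = ρ) (hδ : x ⊓ δ = ρ)
    (hα : α ≤ γ ⊔ δ) (hβ : β ≤ x) : Centralizes α β ρ := by
  intro n m f hf a b u v hab huv h
  -- Implication between the two instances is a preorder on the tuples, so the coordinates of `a`
  -- may be changed one by one.
  refine rel_of_rel_update (r := fun p q => α p q)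
    (P := fun a b : Fin n → A => ρ (f (Sum.elim a u)) (f (Sum.elim a v)) →
      ρ (f (Sum.elim b u)) (f (Sum.elim b v))) (fun _ => id) (fun _ _ _ h h' => h' ∘ h) id ?_
    a b hab h
  intro w i p q hpq
  let s : Setoid A :=
    { r := fun p q => ρ (f (Sum.elim (Function.update w i p) u))
          (f (Sum.elim (Function.update w i p) v)) ↔
        ρ (f (Sum.elim (Function.update w i q) u)) (f (Sum.elim (Function.update w i q) v))
      iseqv := ⟨fun _ => Iff.rfl, Iff.symm, Iff.trans⟩ }
  -- The new pair of values is `x`-related because `u` and `v` are, and `ε`-related by going round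
  -- the other three sides of the rectangle; together this is `ρ`.
  have one : ∀ ε : Congr L A, x ⊓ ε = ρ → ∀ p q, ε p q →
      ρ (f (Sum.elim (Function.update w i p) u)) (f (Sum.elim (Function.update w i p) v)) →
      ρ (f (Sum.elim (Function.update w i q) u)) (f (Sum.elim (Function.update w i q) v)) := by
    intro ε hε p q hpq h
    rw [← hε] at h ⊢
    refine ⟨hf.rel x ?_, ?_⟩
    · rintro (j | j)
      exacts [x.refl _, hβ (huv j)]
    · have side : ∀ u' : Fin m → A, ε (f (Sum.elim (Function.update w i p) u'))
          (f (Sum.elim (Function.update w i q) u')) := by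
        intro u'
        refine hf.rel ε ?_
        rintro (j | j)
        exacts [ε.rel_update w i hpq j, ε.refl _]
      exact ε.trans (ε.symm (side u)) (ε.trans h.2 (side v))
  have hs : s p q := Congr.sup_le_setoid s
    (fun p q h => ⟨one γ hγ p q h, one γ hγ q p (γ.symm h)⟩)
    (fun p q h => ⟨one δ hδ p q h, one δ hδ q p (δ.symm h)⟩) (hα hpq)
  exact hs.1

/-- The congruences `⋀_{i=1}^{5} (αᵢ ∨ βᵢ) ∧ β₆ⁿ`. -/
def herringboneMeet (α β : Fin 6 → Congr L A) (n : ℕ) : Congr L A :=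
  tauFive α β ⊓ herringbone n (tauFive α β) (β 5) (α 5)

theorem herringboneMeet_monotone (α β : Fin 6 → Congr L A) : Monotone (herringboneMeet α β) :=
  fun _ _ h => inf_le_inf_left _ (herringbone_monotone _ _ _ h)

/-- Let γ and δ be the unions of the herringbones starting from β₆ and from α₆. Meeting a stage of
one with `tauFive` puts it below the next stage of the other, so γ and δ have the same meet with
`tauFive`. As τ ≤ α₆ ∨ β₆ ≤ γ ∨ δ, this meet contains [τ, τ]. -/
theorem comm_tau_le (α β : Fin 6 → Congr L A) :
    comm (tau α β) (tau α β) ≤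
      Congr.union (herringboneMeet α β) (herringboneMeet_monotone α β) := by
  have hτ : tau α β ≤ tauFive α β := le_iInf fun i => iInf_le _ i.castSucc
  let γ := Congr.union _ (herringbone_monotone (tauFive α β) (β 5) (α 5))
  let δ := Congr.union _ (herringbone_monotone (tauFive α β) (α 5) (β 5))
  refine sInf_le (centralizes_of_inf_eq (γ := γ) (δ := δ) (x := tauFive α β) ?_ ?_ ?_ hτ)
  · refine Congr.ext' fun a b => ⟨?_, ?_⟩
    · rintro ⟨h, n, h'⟩
      exact ⟨n, h, h'⟩
    · rintro ⟨n, h, h'⟩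
      exact ⟨h, n, h'⟩
  · have swap : ∀ (y z : Congr L A) (n : ℕ) (a b : A), tauFive α β a b →
        herringbone n (tauFive α β) z y a b → herringbone (n + 1) (tauFive α β) y z a b :=
      fun y z n a b h h' => le_sup_right (a := y) (b := tauFive α β ⊓ _) ⟨h, h'⟩
    refine Congr.ext' fun a b => ⟨?_, ?_⟩
    · rintro ⟨h, n, h'⟩
      exact ⟨n + 1, h, swap _ _ n a b h h'⟩
    · rintro ⟨n, h, h'⟩
      exact ⟨h, n + 1, swap _ _ n a b h h'⟩
  · calc tau α β ≤ α 5 ⊔ β 5 := iInf_le _ 5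
      _ ≤ γ ⊔ δ := sup_le
        (le_sup_of_le_right (Congr.le_union _
          (herringbone_monotone (tauFive α β) (α 5) (β 5)) 0))
        (le_sup_of_le_left (Congr.le_union _
          (herringbone_monotone (tauFive α β) (β 5) (α 5)) 0))

end Herringbone

/-! ### Transfer along homomorphisms -/

section Transfer

variable {L : FirstOrder.Language.{u, 0}} {A : Type w} [L.Structure A] {B : Type x} [L.Structure B]
  (h : A → B) (hom : ∀ {n : ℕ} (f : L.Functions n) (v : Fin n → A),
    h (Structure.funMap f v) = Structure.funMap f fun i => h (v i))

include hom

theorem herringbone_le_comap {x y z : Congr L A} {x' y' z' : Congr L B}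
    (hx : x ≤ x'.comap h hom) (hy : y ≤ y'.comap h hom) (hz : z ≤ z'.comap h hom) (n : ℕ) :
    herringbone n x y z ≤ (herringbone n x' y' z').comap h hom := by
  induction n generalizing y z y' z' with
  | zero => exact hy
  | succ n ih =>
    refine sup_le (fun a b hab => le_sup_left (a := y') (hy hab)) fun a b hab => ?_
    exact le_sup_right (a := y') (b := x' ⊓ herringbone n x' z' y') ⟨hx hab.1, ih hz hy hab.2⟩

variable {α β : Fin 6 → Congr L A} {α' β' : Fin 6 → Congr L B} {ρ : Congr L A} {ρ' : Congr L B}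
  (hα : ∀ i, α i ≤ (α' i).comap h hom) (hβ : ∀ i, β i ≤ (β' i).comap h hom)

include hα hβ

theorem sup_le_comap (i : Fin 6) : α i ⊔ β i ≤ (α' i ⊔ β' i).comap h hom :=
  sup_le (fun _ _ hab => le_sup_left (a := α' i) (hα i hab))
    fun _ _ hab => le_sup_right (b := β' i) (hβ i hab)

theorem tau_le_comap : tau α β ≤ (tau α' β').comap h hom :=
  fun _ _ hab => Congr.iInf_apply.2 fun i =>
    sup_le_comap h hom hα hβ i (Congr.iInf_apply.1 hab i)

theorem tauFive_le_comap : tauFive α β ≤ (tauFive α' β').comap h hom :=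
  fun _ _ hab => Congr.iInf_apply.2 fun i =>
    sup_le_comap h hom hα hβ i.castSucc (Congr.iInf_apply.1 hab i)

theorem joinOver_le_comap (S S' : Finset (Fin 6)) :
    joinOver α β S S' ≤ (joinOver α' β' S S').comap h hom :=
  sup_le (iSup₂_le fun _ hj _ _ hab => joinOver_left hj (hα _ hab))
    (iSup₂_le fun _ hj _ _ hab => joinOver_right hj (hβ _ hab))

theorem upperBound_le_comap (hρ : ρ ≤ ρ'.comap h hom) :
    upperBound ρ α β ≤ (upperBound ρ' α' β').comap h hom := by
  have theta_imp : ∀ (R R' : Finset (Fin 6)) (a b : A), theta ρ α β R R' a b →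
      theta ρ' α' β' R R' (h a) (h b) := by
    rintro R R' a b ⟨hL, c, hac, hcb⟩
    exact ⟨joinOver_le_comap h hom hα hβ _ _ hL, h c, hρ hac,
      joinOver_le_comap h hom hα hβ _ _ hcb⟩
  have joinRel_le : ∀ R R' : Finset (Fin 6), joinRel (tau α β) (theta ρ α β R R') ≤
      (joinRel (tau α' β') (theta ρ' α' β' R R')).comap h hom := by
    intro R R'
    refine Congr.gen_le fun a b hab => ?_
    rcases hab with hab | hab
    · exact joinRel_left _ _ (tau_le_comap h hom hα hβ hab)
    · exact joinRel_right _ (theta_imp R R' a b hab)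
  have sigma_imp : ∀ a b, sigma ρ α β a b → sigma ρ' α' β' (h a) (h b) :=
    fun a b hab => ⟨joinRel_le _ _ hab.1, joinRel_le _ _ hab.2⟩
  have hα' : (⨆ i, α i) ≤ (⨆ i, α' i).comap h hom :=
    iSup_le fun i _ _ hab => le_iSup α' i (hα i hab)
  have hβ' : (⨆ i, β i) ≤ (⨆ i, β' i).comap h hom :=
    iSup_le fun i _ _ hab => le_iSup β' i (hβ i hab)
  exact sup_le
    (fun a b hab => le_sup_left (a := (⨆ i, α' i) ⊓ sigma ρ' α' β')
      ⟨hα' hab.1, sigma_imp a b hab.2⟩)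
    (fun a b hab => le_sup_right (b := (⨆ i, β' i) ⊓ sigma ρ' α' β')
      ⟨hβ' hab.1, sigma_imp a b hab.2⟩)

end Transfer

/-! ### Continuity of the upper bound along increasing sequences. -/

section Union

variable {L : FirstOrder.Language.{u, 0}} {A : Type w} [L.Structure A]

theorem upperBound_mono {α β : Fin 6 → Congr L A} {ρ ρ' : Congr L A} (h : ρ ≤ ρ') :
    upperBound ρ α β ≤ upperBound ρ' α β :=
  upperBound_le_comap (fun a => a) (fun _ _ => rfl) (fun _ _ _ h => h) (fun _ _ _ h => h) h

theorem joinRel_mono (τ : Congr L A) {R R' : A → A → Prop} (h : ∀ a b, R a b → R' a b) :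
    joinRel τ R ≤ joinRel τ R' :=
  Congr.gen_le fun a b hab => hab.elim (fun h => joinRel_left _ _ h)
    fun hab => joinRel_right _ (h a b hab)

theorem theta_mono {α β : Fin 6 → Congr L A} {ρ ρ' : Congr L A} (h : ρ ≤ ρ')
    {R R' : Finset (Fin 6)} (a b : A) : theta ρ α β R R' a b → theta ρ' α β R R' a b :=
  fun ⟨hL, c, hac, hcb⟩ => ⟨hL, c, h hac, hcb⟩

/-- Membership in the upper bound uses only finitely many pairs of `ρ`, which all occur at one stage
of the union. -/
theorem upperBound_union {α β : Fin 6 → Congr L A} (ρ : ℕ → Congr L A) (hρ : Monotone ρ) {a b : A}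
    (hab : upperBound (Congr.union ρ hρ) α β a b) : ∃ n, upperBound (ρ n) α β a b := by
  have joinRel_monotone : ∀ R R' : Finset (Fin 6),
      Monotone fun n => joinRel (tau α β) (theta (ρ n) α β R R') :=
    fun R R' n m hnm => joinRel_mono _ (theta_mono (hρ hnm))
  have joinRel_union : ∀ R R' : Finset (Fin 6),
      joinRel (tau α β) (theta (Congr.union ρ hρ) α β R R') ≤
        Congr.union _ (joinRel_monotone R R') := by
    intro R R'
    refine Congr.gen_le fun a b hab => ?_
    rcases hab with hab | ⟨hL, c, ⟨n, hac⟩, hcb⟩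
    · exact ⟨0, joinRel_left _ _ hab⟩
    · exact ⟨n, joinRel_right _ ⟨hL, c, hac, hcb⟩⟩
  have sigma_union : ∀ a b, sigma (Congr.union ρ hρ) α β a b → ∃ n, sigma (ρ n) α β a b := by
    rintro a b ⟨h₁, h₂⟩
    obtain ⟨n, hn⟩ := joinRel_union _ _ h₁
    obtain ⟨m, hm⟩ := joinRel_union _ _ h₂
    exact ⟨max n m, joinRel_monotone _ _ (le_max_left n m) hn,
      joinRel_monotone _ _ (le_max_right n m) hm⟩
  have le : upperBound (Congr.union ρ hρ) α β ≤
      Congr.union (fun n => upperBound (ρ n) α β) fun n m hnm => upperBound_mono (hρ hnm) := by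
    refine sup_le ?_ ?_
    · rintro a b ⟨h, hσ⟩
      obtain ⟨n, hn⟩ := sigma_union a b hσ
      exact ⟨n, le_sup_left (a := (⨆ i, α i) ⊓ sigma (ρ n) α β) ⟨h, hn⟩⟩
    · rintro a b ⟨h, hσ⟩
      obtain ⟨n, hn⟩ := sigma_union a b hσ
      exact ⟨n, le_sup_right (b := (⨆ i, β i) ⊓ sigma (ρ n) α β) ⟨h, hn⟩⟩
  exact le hab

end Union

/-! ### The generic instance of the inclusion -/

namespace Variety

variable {L : FirstOrder.Language.{u, 0}} (V : Variety L)

/-- The free algebra on `a = 0`, `b = 1` and `cᵢ = i + 2`. -/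
abbrev Generic : Type u := V.Free (Fin 8)

/-- The number of the generator `cᵢ`. -/
def mid (i : Fin 6) : Fin 8 := ⟨i + 2, by omega⟩

/-- The congruence generated by `(a, cᵢ)`. -/
noncomputable def genericLeft (i : Fin 6) : Congr L V.Generic :=
  Congr.gen fun p q => p = V.gen 0 ∧ q = V.gen (mid i)

/-- The congruence generated by `(cᵢ, b)`. -/
noncomputable def genericRight (i : Fin 6) : Congr L V.Generic :=
  Congr.gen fun p q => p = V.gen (mid i) ∧ q = V.gen 1

theorem generic_comp (i : Fin 6) :
    Relation.Comp (V.genericLeft i) (V.genericRight i) (V.gen 0) (V.gen 1) :=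
  ⟨V.gen (mid i), Congr.gen_of ⟨rfl, rfl⟩, Congr.gen_of ⟨rfl, rfl⟩⟩

/-- Any a, b, cᵢ in an algebra of `V` are the image of the generators, and the upper bound is
preserved by homomorphisms. So the stage found for the generic pair is uniform. -/
theorem exists_herringbone_inclusion
    (h : TaylorInclusion (comm (tau V.genericLeft V.genericRight)
      (tau V.genericLeft V.genericRight)) V.genericLeft V.genericRight) :
    ∃ n : ℕ, ∀ (A : Type u) [L.Structure A], V.Mem A → ∀ α β : Fin 6 → Congr L A,
      TaylorInclusion (tauFive α β ⊓ herringbone n (tauFive α β) (β 5) (α 5)) α β := by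
  obtain ⟨n, hn⟩ := upperBound_union _ (herringboneMeet_monotone _ _)
    (upperBound_mono (comm_tau_le _ _)
      (taylorInclusion_iff.1 h (V.gen 0) (V.gen 1) V.generic_comp))
  refine ⟨n, fun A _ hA α β => taylorInclusion_iff.2 fun a b hab => ?_⟩
  have hex : ∀ i, ∃ c, α i a c ∧ β i c b := hab
  choose c hac hcb using hex
  let v : Fin 8 → A := Fin.cons a (Fin.cons b c)
  have hmid : ∀ i, v (mid i) = c i := fun i => rfl
  let e : V.Generic → A := V.lift v
  have hom : ∀ {n : ℕ} (f : L.Functions n) (w : Fin n → V.Generic),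
      e (Structure.funMap f w) = Structure.funMap f fun i => e (w i) :=
    fun f w => V.lift_funMap hA v f w
  have hα : ∀ i, V.genericLeft i ≤ (α i).comap e hom := by
    refine fun i => Congr.gen_le ?_
    rintro p q ⟨rfl, rfl⟩
    change α i (V.lift v _) (V.lift v _)
    rw [V.lift_gen hA, V.lift_gen hA]
    exact hac i
  have hβ : ∀ i, V.genericRight i ≤ (β i).comap e hom := by
    refine fun i => Congr.gen_le ?_
    rintro p q ⟨rfl, rfl⟩
    change β i (V.lift v _) (V.lift v _)
    rw [V.lift_gen hA, V.lift_gen hA]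
    exact hcb i
  have h5 := tauFive_le_comap e hom hα hβ
  have hρ : herringboneMeet V.genericLeft V.genericRight n ≤
      (herringboneMeet α β n).comap e hom :=
    fun p q hpq => ⟨h5 hpq.1, herringbone_le_comap e hom h5 (hβ 5) (hα 5) n hpq.2⟩
  have := upperBound_le_comap e hom hα hβ hρ hn
  change upperBound _ α β (V.lift v _) (V.lift v _) at this
  rwa [V.lift_gen hA, V.lift_gen hA] at this

end Variety

namespace Variety

variable {L : FirstOrder.Language.{u, 0}} (V : Variety L)

/-! ### Selecting variables in a variety that is not Taylor -/

theorem idempotent_of_realize {V : Variety L} {n : ℕ} {t : L.Term (Fin n)}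
    (h : ∀ (A : Type u) [L.Structure A], V.Mem A → ∀ a : A, t.realize (fun _ => a) = a) :
    V.Idempotent t := by
  intro A _ hA v
  rw [Term.realize_relabel]
  exact h A hA (v 0)

/-- In a star product of idempotent terms, identifying the inner variables within each copy recovers
the outer term, and identifying corresponding variables across copies recovers the inner one.
Renamings into two variables suffice for Taylor identities. -/
theorem exists_common_star (S : Finset {t : L.Term (Fin 8) // V.Idempotent t}) :
    ∃ (N : ℕ) (T : L.Term (Fin N)) (e : {t : L.Term (Fin 8) // V.Idempotent t} → Fin N → Fin 8),
      V.Idempotent T ∧ ∀ s ∈ S, ∀ π : Fin 8 → Fin 2, V.Sat (T.relabel (π ∘ e s)) (s.1.relabel π) := by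
  classical
  induction S using Finset.induction_on with
  | empty =>
    exact ⟨1, Term.var 0, fun _ _ => 0, idempotent_of_realize fun _ _ _ _ => rfl, by simp⟩
  | insert s S hs ih =>
    obtain ⟨N, T, e, hT, he⟩ := ih
    refine ⟨N * 8, (star T s.1).relabel finProdFinEquiv,
      fun s' k => if s' = s then (finProdFinEquiv.symm k).2 else e s' (finProdFinEquiv.symm k).1,
      idempotent_of_realize fun A _ hA a => ?_, fun s' hs' π A _ hA v => ?_⟩
    · rw [Term.realize_relabel, realize_star]
      have : (fun k : Fin N => s.1.realize fun l => ((fun _ => a) ∘ finProdFinEquiv) (k, l)) =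
          fun _ => a := funext fun k => s.2.realize_const hA a
      rw [this, hT.realize_const hA]
    · rw [Term.realize_relabel, Term.realize_relabel, Term.realize_relabel, realize_star]
      by_cases h : s' = s
      · subst h
        simp only [Function.comp, Equiv.symm_apply_apply, if_true]
        exact hT.realize_const hA _
      · simp only [Function.comp, Equiv.symm_apply_apply, if_neg h]
        have hmem : s' ∈ S := (Finset.mem_insert.1 hs').resolve_left h
        have := he s' hmem π A hA v
        rw [Term.realize_relabel, Term.realize_relabel] at this
        have hconst : (fun k : Fin N => s.1.realize fun _ : Fin 8 => v (π (e s' k))) =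
            v ∘ π ∘ e s' := funext fun k => s.2.realize_const hA _
        rw [hconst]
        exact this

/-- If `V` is not Taylor, then one can choose a variable of every idempotent term in such a way
that all linear equations between idempotent terms are respected. -/
theorem exists_selection (h : ¬ V.IsTaylor) :
    ∃ g : {t : L.Term (Fin 8) // V.Idempotent t} → Fin 8, ∀ s t, ∀ π σ : Fin 8 → Fin 8,
      V.Sat (s.1.relabel π) (t.1.relabel σ) → π (g s) = σ (g t) := by
  classical
  have finite : ∀ S : Finset {t : L.Term (Fin 8) // V.Idempotent t},
      ∃ g : {t : L.Term (Fin 8) // V.Idempotent t} → Fin 8, ∀ s ∈ S, ∀ t ∈ S,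
        ∀ π σ : Fin 8 → Fin 8, V.Sat (s.1.relabel π) (t.1.relabel σ) → π (g s) = σ (g t) := by
    intro S
    obtain ⟨N, T, e, hT, he⟩ := V.exists_common_star S
    -- The idempotent term `T` is not a Taylor term, so some position `i` carries the same variable
    -- on both sides of every two-variable identity of `T`. Reading off that position selects a
    -- variable of every `s` in `S`.
    obtain ⟨i, hi⟩ : ∃ i : Fin N, ∀ p q : Fin N → Fin 2, p i ≠ q i →
        ¬ V.Sat (T.relabel p) (T.relabel q) := by
      by_contra hcon
      push Not at hcon
      choose p q hpq using hcon
      exact h ⟨N, T, hT, p, q, hpq⟩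
    refine ⟨fun s => e s i, fun s hs t ht π σ hst => ?_⟩
    by_contra hne
    -- Two variables are enough to separate π(g s) from σ(g t), so a violated linear equation would
    -- give an identity of `T` that is forbidden at `i`.
    let ind : Fin 8 → Fin 2 := fun j => if j = π (e s i) then 0 else 1
    refine hi (ind ∘ π ∘ e s) (ind ∘ σ ∘ e t) ?_ ?_
    · simp [ind, Ne.symm hne]
    · refine (he s hs (ind ∘ π)).trans (Sat.trans ?_ (he t ht (ind ∘ σ)).symm)
      intro A _ hA v
      have := hst A hA (v ∘ ind)
      simp only [Term.realize_relabel] at this ⊢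
      exact this
  choose g hg using finite
  -- Compactness: on each finite set, `χ` agrees with the choice made for some larger finite set.
  obtain ⟨χ, hχ⟩ := Finset.rado_selection g
  refine ⟨χ, fun s t π σ hst => ?_⟩
  obtain ⟨S, hS, heq⟩ := hχ {s, t}
  rw [heq s (by simp), heq t (by simp)]
  exact hg S s (hS (by simp)) t (hS (by simp)) π σ hst

/-- The kernel of the endomorphism of the generic algebra that renames the generators. -/
noncomputable def kernel (κ : Fin 8 → Fin 8) : Congr L V.Generic :=
  Congr.comap (V.lift fun i => V.gen (κ i))
    (fun f w => V.lift_funMap (V.free_mem _) _ f w) ⊥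

theorem kernel_apply {κ : Fin 8 → Fin 8} {p q : V.Generic} : V.kernel κ p q ↔
    V.Sat (((V.freeCongr _).rep p).relabel κ) (((V.freeCongr _).rep q).relabel κ) := by
  have key : ∀ p : V.Generic, V.lift (fun i => V.gen (κ i)) p =
      (V.freeCongr _).cls (((V.freeCongr _).rep p).relabel κ) := by
    intro p
    unfold lift
    generalize (V.freeCongr _).rep p = t
    rw [show (fun i => V.gen (κ i)) = fun i => (V.freeCongr (Fin 8)).cls (Term.var (κ i)) from rfl,
      Congr.realize_cls, realize_term]
    congr 1
    induction t with
    | var i => rfl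
    | func f ts ih => simp only [Term.subst, Term.relabel, ih]
  change V.lift _ p = V.lift _ q ↔ _
  rw [key, key, Congr.cls_eq_iff]
  rfl

theorem kernel_gen {κ : Fin 8 → Fin 8} {i j : Fin 8} (h : κ i = κ j) :
    V.kernel κ (V.gen i) (V.gen j) := by
  change V.lift _ _ = V.lift _ _
  rw [V.lift_gen (V.free_mem _), V.lift_gen (V.free_mem _), h]

theorem genericLeft_le_kernel {κ : Fin 8 → Fin 8} {i : Fin 6} (h : κ 0 = κ (mid i)) :
    V.genericLeft i ≤ V.kernel κ := by
  refine Congr.gen_le ?_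
  rintro p q ⟨rfl, rfl⟩
  exact V.kernel_gen h

theorem genericRight_le_kernel {κ : Fin 8 → Fin 8} {i : Fin 6} (h : κ (mid i) = κ 1) :
    V.genericRight i ≤ V.kernel κ := by
  refine Congr.gen_le ?_
  rintro p q ⟨rfl, rfl⟩
  exact V.kernel_gen h

theorem joinOver_le_kernel {κ : Fin 8 → Fin 8} {S S' : Finset (Fin 6)}
    (h : ∀ i ∈ S, κ 0 = κ (mid i)) (h' : ∀ i ∈ S', κ (mid i) = κ 1) :
    joinOver V.genericLeft V.genericRight S S' ≤ V.kernel κ :=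
  sup_le (iSup₂_le fun i hi => V.genericLeft_le_kernel (h i hi))
    (iSup₂_le fun i hi => V.genericRight_le_kernel (h' i hi))

/-- The value `none` marks the elements given by non-idempotent terms. A renaming kernel never
relates these to idempotent ones, as setting all variables equal shows. -/
theorem exists_partial_selection (h : ¬ V.IsTaylor) :
    ∃ sel : V.Generic → Option (Fin 8), (∀ i, sel (V.gen i) = some i) ∧
      ∀ κ p q, V.kernel κ p q → (sel p).map κ = (sel q).map κ := by
  classical
  obtain ⟨g, hg⟩ := V.exists_selection h
  let rep := (V.freeCongr (Fin 8)).rep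
  refine ⟨fun p => if hp : V.Idempotent (rep p) then some (g ⟨rep p, hp⟩) else none,
    fun i => ?_, fun κ p q hpq => ?_⟩
  · have hi : V.Sat (rep (V.gen i)) (Term.var i) :=
      (V.freeCongr _).cls_eq_iff.1 ((V.freeCongr _).cls_rep (V.gen i))
    have hidem : V.Idempotent (rep (V.gen i)) :=
      idempotent_of_realize fun A _ hA a => hi A hA fun _ => a
    simp only [dif_pos hidem, Option.some_inj]
    by_contra hne
    -- Both renamings fix `i`, so both images of the term equal the variable `i`. They disagree at
    -- every other index, so no other index can have been selected.
    have := hg ⟨_, hidem⟩ ⟨_, hidem⟩ (fun _ => i) (fun j => if j = i then i else i + 1)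
      (((hi.relabel _).trans (by simpa [Term.relabel] using Sat.refl _)).trans (hi.relabel _).symm)
    simp only [if_neg hne] at this
    omega
  · rw [kernel_apply] at hpq
    have transfer : ∀ s t : L.Term (Fin 8), V.Sat (s.relabel κ) (t.relabel κ) →
        V.Idempotent s → V.Idempotent t := by
      intro s t hst hs
      refine idempotent_of_realize fun A _ hA a => ?_
      have := hst A hA fun _ => a
      rw [Term.realize_relabel, Term.realize_relabel] at this
      exact this.symm.trans (hs.realize_const hA a)
    by_cases hp : V.Idempotent (rep p)
    · have hq : V.Idempotent (rep q) := transfer _ _ hpq hp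
      simp only [dif_pos hp, dif_pos hq, Option.map_some, Option.some_inj]
      exact hg ⟨_, hp⟩ ⟨_, hq⟩ κ κ hpq
    · have hq : ¬ V.Idempotent (rep q) := fun hq => hp (transfer _ _ hpq.symm hq)
      simp only [dif_neg hp, dif_neg hq, Option.map_none]

/-! ### Failure of the inclusion in a variety that is not Taylor -/

/-- The renaming that identifies `a` and `cᵢ`. -/
def foldLeft (i : Fin 6) (j : Fin 8) : Fin 8 := if j = mid i then 0 else j

/-- The renaming that identifies `b` and `cᵢ`. -/
def foldRight (i : Fin 6) (j : Fin 8) : Fin 8 := if j = mid i then 1 else j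

/-- The renaming that identifies `a`, `b` and `cᵢ`. -/
def foldBoth (i : Fin 6) (j : Fin 8) : Fin 8 := if j = mid i ∨ j = 1 then 0 else j

/-- This evaluates meets of partitions: `h` says that the joint kernel of the `κ i` refines the
kernel of `κ'`. Nonemptiness of `ι` is what keeps `none` apart from `some`. -/
theorem map_eq_of_forall {ι : Type*} (κ : ι → Fin 8 → Fin 8) (κ' : Fin 8 → Fin 8) [Nonempty ι]
    (h : ∀ k l, (∀ i, κ i k = κ i l) → κ' k = κ' l) {o o' : Option (Fin 8)}
    (ho : ∀ i, o.map (κ i) = o'.map (κ i)) : o.map κ' = o'.map κ' := by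
  rcases o with _ | k <;> rcases o' with _ | l
  · rfl
  · simpa using ho (Classical.arbitrary ι)
  · simpa using ho (Classical.arbitrary ι)
  · simp only [Option.map_some, Option.some_inj] at ho ⊢
    exact h k l ho

/-- Through `sel`, each congruence on the right side is bounded by a partition of {a, b, c₁, …, c₆},
namely the one obtained by computing with partitions instead. The final partition is discrete, but a
and b are selected as distinct points. -/
theorem not_upperBound (sel : V.Generic → Option (Fin 8)) (hgen : ∀ i, sel (V.gen i) = some i)
    (hker : ∀ κ p q, V.kernel κ p q → (sel p).map κ = (sel q).map κ) (n : ℕ) :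
    ¬ upperBound (herringboneMeet V.genericLeft V.genericRight n) V.genericLeft V.genericRight
      (V.gen 0) (V.gen 1) := by
  let s : (Fin 8 → Fin 8) → Setoid V.Generic := fun κ => Setoid.ker fun p => (sel p).map κ
  have hboth : ∀ i p q, (V.genericLeft i ⊔ V.genericRight i) p q →
      (sel p).map (foldBoth i) = (sel q).map (foldBoth i) := by
    intro i p q hpq
    have h₁ : ∀ i, foldBoth i 0 = foldBoth i (mid i) := by decide
    have h₂ : ∀ i, foldBoth i (mid i) = foldBoth i 1 := by decide
    exact hker _ _ _ ((sup_le (V.genericLeft_le_kernel (h₁ i)) (V.genericRight_le_kernel (h₂ i)) :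
      _ ≤ V.kernel (foldBoth i)) hpq)
  have htau : ∀ (κ : Fin 8 → Fin 8), (∀ k l, (∀ i, foldBoth i k = foldBoth i l) → κ k = κ l) →
      ∀ p q, tau V.genericLeft V.genericRight p q → (sel p).map κ = (sel q).map κ :=
    fun κ hκ p q hpq => map_eq_of_forall foldBoth κ hκ fun i =>
      hboth i p q (Congr.iInf_apply.1 hpq i)
  have hfive : ∀ (κ κ' : Fin 8 → Fin 8),
      (∀ k l, (∀ i : Option (Fin 5), i.elim κ (fun i => foldBoth i.castSucc) k =
        i.elim κ (fun i => foldBoth i.castSucc) l) → κ' k = κ' l) →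
      ∀ p q, tauFive V.genericLeft V.genericRight p q → (sel p).map κ = (sel q).map κ →
        (sel p).map κ' = (sel q).map κ' := by
    intro κ κ' hκ p q hpq hp
    refine map_eq_of_forall (fun i : Option (Fin 5) => i.elim κ fun i => foldBoth i.castSucc) κ' hκ
      fun i => ?_
    rcases i with _ | i
    exacts [hp, hboth _ p q (Congr.iInf_apply.1 hpq i)]
  -- On the eight points `tauFive` joins only a and b, so its meet with {a, c₆} or {b, c₆} is
  -- discrete and the herringbones never grow.
  have hherr : ∀ n, (∀ p q, herringbone n (tauFive V.genericLeft V.genericRight)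
        (V.genericRight 5) (V.genericLeft 5) p q →
        (sel p).map (foldRight 5) = (sel q).map (foldRight 5)) ∧
      (∀ p q, herringbone n (tauFive V.genericLeft V.genericRight)
        (V.genericLeft 5) (V.genericRight 5) p q →
        (sel p).map (foldLeft 5) = (sel q).map (foldLeft 5)) := by
    have h₁ : ∀ p q, V.genericRight 5 p q →
        (sel p).map (foldRight 5) = (sel q).map (foldRight 5) :=
      fun p q hpq => hker _ _ _ (V.genericRight_le_kernel (by decide) hpq)
    have h₂ : ∀ p q, V.genericLeft 5 p q →
        (sel p).map (foldLeft 5) = (sel q).map (foldLeft 5) :=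
      fun p q hpq => hker _ _ _ (V.genericLeft_le_kernel (by decide) hpq)
    intro n
    induction n with
    | zero => exact ⟨h₁, h₂⟩
    | succ n ih =>
      exact ⟨fun p q hpq => Congr.sup_le_setoid (s _) h₁
          (by exact fun p q hpq => hfive _ _ (by decide) p q hpq.1 (ih.2 p q hpq.2)) hpq,
        fun p q hpq => Congr.sup_le_setoid (s _) h₂
          (by exact fun p q hpq => hfive _ _ (by decide) p q hpq.1 (ih.1 p q hpq.2)) hpq⟩
  have hmeet : ∀ p q, herringboneMeet V.genericLeft V.genericRight n p q → sel p = sel q := by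
    intro p q hpq
    simpa using hfive _ id (by decide) p q hpq.1 ((hherr n).1 p q hpq.2)
  -- The fixed vector is the partition ac₁c₅c₆ | bc₂c₃c₄ given by the left index sets, and `ρ` is
  -- the one given by `R`, `R'`. Their meet, together with the block ab of τ, must refine the kernel
  -- of `κ`. The left factor of the product disappears because `hmeet` makes it trivial.
  have hjoin : ∀ (κ ρ : Fin 8 → Fin 8) (R R' : Finset (Fin 6)),
      (∀ k l, (∀ i, foldBoth i k = foldBoth i l) → κ k = κ l) →
      (∀ i ∈ R, ρ 0 = ρ (mid i)) → (∀ i ∈ R', ρ (mid i) = ρ 1) →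
      (∀ k l, (∀ i : Bool, (bif i then ![0, 1, 0, 1, 1, 1, 0, 0] else ρ) k =
        (bif i then ![0, 1, 0, 1, 1, 1, 0, 0] else ρ) l) → κ k = κ l) →
      ∀ p q, joinRel (tau V.genericLeft V.genericRight)
        (theta (herringboneMeet V.genericLeft V.genericRight n) V.genericLeft V.genericRight R R')
        p q → (sel p).map κ = (sel q).map κ := by
    intro κ ρ R R' hκ hR hR' hρ p q hpq
    refine Congr.gen_le_setoid (Congr.TranslationClosed.or (Congr.translationClosed _)
      (Congr.translationClosed_theta _ _ _ R R')) (s κ) (fun p q hpq => ?_) hpq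
    rcases hpq with hpq | ⟨hL, r, hpr, hrq⟩
    · exact htau κ hκ p q hpq
    · refine map_eq_of_forall (fun i : Bool => bif i then ![0, 1, 0, 1, 1, 1, 0, 0] else ρ) κ hρ
        fun i => ?_
      cases i
      · change (sel p).map ρ = (sel q).map ρ
        rw [hmeet p r hpr]
        exact hker _ _ _ (V.joinOver_le_kernel hR hR' hrq)
      · exact hker ![0, 1, 0, 1, 1, 1, 0, 0] _ _
          (V.joinOver_le_kernel (by decide) (by decide) hL)
  -- The two vectors are abc₃c₆ | c₁c₅ | c₂c₄ and abc₂c₅ | c₁c₆ | c₃c₄. Their meet joins only a and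
  -- b, so any `κ` separating a from b makes it discrete.
  have hsigma : ∀ κ : Fin 8 → Fin 8, (∀ k l, (∀ i : Fin 3, (![![0, 0, 1, 2, 0, 2, 1, 0],
        ![0, 0, 1, 0, 2, 2, 0, 1], κ] : Fin 3 → Fin 8 → Fin 8) i k =
        (![![0, 0, 1, 2, 0, 2, 1, 0], ![0, 0, 1, 0, 2, 2, 0, 1], κ] :
          Fin 3 → Fin 8 → Fin 8) i l) → k = l) →
      ∀ p q, (sel p).map κ = (sel q).map κ →
      sigma (herringboneMeet V.genericLeft V.genericRight n) V.genericLeft V.genericRight p q →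
      sel p = sel q := by
    intro κ hκ p q hpq hσ
    have := map_eq_of_forall _ id hκ (o := sel p) (o' := sel q) fun i => by
      fin_cases i
      · exact hjoin ![0, 0, 1, 2, 0, 2, 1, 0] ![0, 1, 1, 0, 1, 0, 1, 0] _ _ (by decide) (by decide) (by decide) (by decide)
          p q hσ.1
      · exact hjoin ![0, 0, 1, 0, 2, 2, 0, 1] ![0, 1, 1, 1, 0, 0, 0, 1] _ _ (by decide) (by decide) (by decide) (by decide)
          p q hσ.2
      · exact hpq
    simpa using this
  intro hub
  have : sel (V.gen 0) = sel (V.gen 1) := by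
    refine Congr.sup_le_setoid (Setoid.ker sel) ?_ ?_ hub
    · rintro p q ⟨hp, hσ⟩
      -- The join of all αᵢ leaves b alone; below, the join of all βᵢ leaves a alone.
      refine hsigma ![0, 1, 0, 0, 0, 0, 0, 0] (by decide) p q (hker _ _ _ ?_) hσ
      exact (iSup_le fun i => V.genericLeft_le_kernel (by revert i; decide) :
        (⨆ i, V.genericLeft i) ≤ V.kernel _) hp
    · rintro p q ⟨hp, hσ⟩
      refine hsigma ![0, 1, 1, 1, 1, 1, 1, 1] (by decide) p q (hker _ _ _ ?_) hσ
      exact (iSup_le fun i => V.genericRight_le_kernel (by revert i; decide) :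
        (⨆ i, V.genericRight i) ≤ V.kernel _) hp
  rw [hgen, hgen] at this
  exact absurd this (by decide)

theorem isTaylor_of_inclusion (n : ℕ) (h : TaylorInclusion
    (herringboneMeet V.genericLeft V.genericRight n) V.genericLeft V.genericRight) :
    V.IsTaylor := by
  by_contra hV
  obtain ⟨sel, hgen, hker⟩ := V.exists_partial_selection hV
  exact V.not_upperBound sel hgen hker n
    (taylorInclusion_iff.1 h (V.gen 0) (V.gen 1) V.generic_comp)

end Variety

end UA

theorem theorem4p3 (L : FirstOrder.Language.{u, 0}) [L.IsAlgebraic] (V : UA.Variety L) :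
    List.TFAE [
      V.IsTaylor,
      V.idempReduct.abelianPart.IsTaylor,
      ∃ t : L.Term (Fin 6),
        V.SatComm (t.relabel ![(0 : Fin 2), 1, 1, 1, 0, 0]) (t.relabel ![1, 0, 1, 0, 1, 0]) ∧
        V.SatComm (t.relabel ![(1 : Fin 2), 0, 1, 0, 1, 0]) (t.relabel ![1, 1, 0, 0, 0, 1]) ∧
        V.SatComm (t.relabel ![(0 : Fin 1), 0, 0, 0, 0, 0]) (FirstOrder.Language.Term.var 0),
      ∀ (A : Type u) [L.Structure A], V.Mem A → ∀ α β : Fin 6 → UA.Congr L A,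
        UA.TaylorInclusion (UA.comm (UA.tau α β) (UA.tau α β)) α β,
      ∃ n : ℕ, ∀ (A : Type u) [L.Structure A], V.Mem A → ∀ α β : Fin 6 → UA.Congr L A,
        UA.TaylorInclusion
          (UA.tauFive α β ⊓ UA.herringbone n (UA.tauFive α β) (β 5) (α 5)) α β] := by
  tfae_have 1 → 2 := UA.Variety.IsTaylor.abelianPart_idempReduct
  tfae_have 2 → 3 := UA.Variety.exists_olsak_commutator_term
  tfae_have 3 → 4 := fun ⟨t, h₁, h₂, h₃⟩ A _ hA =>
    UA.taylorInclusion_of_term t (h₁ A hA) (h₂ A hA) (h₃ A hA)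
  tfae_have 4 → 5 := fun h => V.exists_herringbone_inclusion (h _ (V.free_mem _) _ _)
  tfae_have 5 → 1 := fun ⟨n, h⟩ => V.isTaylor_of_inclusion n (h _ (V.free_mem _) _ _)
  tfae_finish
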